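/- A set $S$ of points in the plane is in \emph{general$^+$ position} if no three distinct points of $S$ are collinear and no three lines through six distinct points of $S$ (each line passing through two of the six points) have a common point. \textbf{Theorem.} Let $n\ge 3$, let $P=P_1P_2\dots P_n$ be a convex polygon in the plane (vertices listed in cyclic order, no flat angles), let $A=\{A_1,\dots,A_m\}$ be a set of $m\ge 0$ distinct points in the interior of $P$ such that $\{P_1,\dots,P_n\}\cup A$ is in general$^+$ position, and let $c_1,\dots,c_n$ be nonnegative integers with $\sum_{i=1}^n c_i=m$. Then the closed region bounded by $P$ is the union of $n$ closed convex polygonal regions $R_1,\dots,R_n$ with nonempty, pairwise disjoint interiors such that, for each $i$ (with $P_{n+1}=P_1$), the segment $P_iP_{i+1}$ is an edge of $R_i$, no point of $A$ lies on the boundary of $R_i$, and exactly $c_i$ points of $A$ lie in the interior of $R_i$. -/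

import Mathlib

/-- The Euclidean plane. -/
abbrev Plane : Type := EuclideanSpace ℝ (Fin 2)

/-- A set of points in the plane is in general position if no three distinct points of it are
collinear. -/
def InGeneralPosition (S : Set Plane) : Prop :=
  ∀ a ∈ S, ∀ b ∈ S, ∀ c ∈ S, a ≠ b → a ≠ c → b ≠ c → ¬ Collinear ℝ {a, b, c}

/-- A set of points in the plane is in general⁺ position if it is in general position and
no three lines through six distinct points of it (each line through two of the six points)
have a common point. -/
def InGeneralPlusPosition (S : Set Plane) : Prop :=
  InGeneralPosition S ∧
    ∀ p : Fin 6 → Plane, Function.Injective p → (∀ k, p k ∈ S) →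
      ¬ ∃ x : Plane, x ∈ line[ℝ, p 0, p 1] ∧ x ∈ line[ℝ, p 2, p 3] ∧ x ∈ line[ℝ, p 4, p 5]

/-- A polygon, given by its vertices in cyclic order, is convex (without flat angles): it has at
least three vertices, and for each edge all vertices other than the two endpoints of the edge lie
strictly on the same side of the line through the edge. -/
def Polygon.IsConvex {n : ℕ} (P : Polygon Plane n) : Prop :=
  3 ≤ n ∧ ∀ i j k : Fin n, j ≠ i → j ≠ finRotate n i → k ≠ i → k ≠ finRotate n i →
    (line[ℝ, P i, P (finRotate n i)]).SSameSide (P j) (P k)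

/-- The closed region bounded by a convex polygon: the convex hull of its vertices. -/
def Polygon.region {n : ℕ} (P : Polygon Plane n) : Set Plane :=
  convexHull ℝ (Set.range P.vertices)

/-- A (closed, non-degenerate) convex polygonal region: a bounded set with nonempty interior that
is the intersection of finitely many closed half-planes. -/
def IsConvexPolygonalRegion (R : Set Plane) : Prop :=
  Bornology.IsBounded R ∧ (interior R).Nonempty ∧
    ∃ F : Finset (Plane × ℝ), R = {x | ∀ f ∈ F, inner ℝ f.1 x ≤ f.2}

open scoped Matrix

/-! Give each edge an affine functional `f i`, zero on the edge and positive inside, and let `R i`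
be the part of the polygon where the i-th functional is smallest. Such cells are convex, cover the
polygon and have disjoint interiors; positive scaling of the functionals changes the cells but keeps
edge i in cell i. To reach the counts `c i`, minimise the sum of `log (f (σ a) a)` over assignments
`σ` with these counts. Optimality excludes negative reassignment cycles, so potentials `u` exist
(duality, via shortest paths), and scaling by `exp (u i)` makes the assigned functional minimal at
each point (`exists_scaling`).

Ties remain: a point may lie in several cells. To break them, add to each functional a small affine
term interpolating heights `h` at the two ends of its edge; neighbours still agree at their common
vertex. A second optimal assignment, now only along ties, gives strict potentials, provided no cycle
of ties has weight zero. Each such weight is linear in `h` and there are finitely many, so it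
suffices that none vanishes identically (`exists_interp_sum_ne_zero`). If one did, its coefficients
would give one relation per vertex. A cycle missing some edge then makes a vertex collinear with two
points of `A`. A cycle through all edges cannot cross itself, so it runs once around the polygon,
and the lines joining the vertices to distinct points of `A` are concurrent. General⁺ position
forbids both. -/

/-! ### Homogeneous coordinates and determinants -/

/-- Homogeneous coordinates of a point of the plane. -/
def hom (x : Plane) : Fin 3 → ℝ := ![x 0, x 1, 1]

/-- The determinant of three vectors of `ℝ³`. -/
def det3 (u v w : Fin 3 → ℝ) : ℝ :=
  u 0 * (v 1 * w 2 - v 2 * w 1) - u 1 * (v 0 * w 2 - v 2 * w 0) + u 2 * (v 0 * w 1 - v 1 * w 0)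

theorem dot_hom (u : Fin 3 → ℝ) (x : Plane) : u ⬝ᵥ hom x = u 0 * x 0 + u 1 * x 1 + u 2 := by
  simp [hom, dotProduct, Fin.sum_univ_three]

theorem hom_injective : Function.Injective hom := by
  intro x y h
  ext i
  fin_cases i
  · simpa [hom] using congrFun h 0
  · simpa [hom] using congrFun h 1

theorem det3_mul_det3 (u v w x y z : Fin 3 → ℝ) :
    det3 u v w * det3 x y z =
      det3 ![u ⬝ᵥ x, u ⬝ᵥ y, u ⬝ᵥ z] ![v ⬝ᵥ x, v ⬝ᵥ y, v ⬝ᵥ z] ![w ⬝ᵥ x, w ⬝ᵥ y, w ⬝ᵥ z] := by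
  simp [det3, dotProduct, Fin.sum_univ_three]
  ring

theorem det3_rotate (u v w : Fin 3 → ℝ) : det3 v w u = det3 u v w := by
  simp only [det3]; ring

theorem eq_zero_of_dot_eq_zero {u v w z : Fin 3 → ℝ} (h : det3 u v w ≠ 0) (hu : u ⬝ᵥ z = 0)
    (hv : v ⬝ᵥ z = 0) (hw : w ⬝ᵥ z = 0) : z = 0 := by
  simp only [dotProduct, Fin.sum_univ_three] at hu hv hw
  have h0 : det3 u v w * z 0 = 0 := by
    simp only [det3]
    linear_combination (v 1 * w 2 - v 2 * w 1) * hu - (u 1 * w 2 - u 2 * w 1) * hv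
      + (u 1 * v 2 - u 2 * v 1) * hw
  have h1 : det3 u v w * z 1 = 0 := by
    simp only [det3]
    linear_combination -(v 0 * w 2 - v 2 * w 0) * hu + (u 0 * w 2 - u 2 * w 0) * hv
      - (u 0 * v 2 - u 2 * v 0) * hw
  have h2 : det3 u v w * z 2 = 0 := by
    simp only [det3]
    linear_combination (v 0 * w 1 - v 1 * w 0) * hu - (u 0 * w 1 - u 1 * w 0) * hv
      + (u 0 * v 1 - u 1 * v 0) * hw
  ext i
  fin_cases i
  · simpa [h] using h0
  · simpa [h] using h1
  · simpa [h] using h2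

theorem det3_transpose_eq_zero {x y z u : Fin 3 → ℝ} (h : det3 x y z ≠ 0) (hx : u ⬝ᵥ x = 0)
    (hy : u ⬝ᵥ y = 0) (hz : u ⬝ᵥ z = 0) : u = 0 :=
  eq_zero_of_dot_eq_zero h (by rw [dotProduct_comm, hx]) (by rw [dotProduct_comm, hy])
    (by rw [dotProduct_comm, hz])

/-- The linear dependence among four vectors of `ℝ³`, arranged so that all coefficients have one
sign when `a, b, c, d` are cyclically ordered. -/
theorem det3_four_term (a b c d x : Fin 3 → ℝ) :
    det3 b c d * (a ⬝ᵥ x) + det3 a b d * (c ⬝ᵥ x) =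
      det3 a c d * (b ⬝ᵥ x) + det3 a b c * (d ⬝ᵥ x) := by
  simp only [det3, dotProduct, Fin.sum_univ_three]
  ring

theorem det3_pluecker (x a b c d : Fin 3 → ℝ) :
    det3 x b d * det3 x a c = det3 x a b * det3 x c d + det3 x a d * det3 x b c := by
  simp only [det3]
  ring

/-! ### Cyclic indices -/

section CyclicIndices

variable {m : ℕ}

theorem fin_add_one_ne (i : Fin (m + 3)) : i + 1 ≠ i := by
  simp

theorem fin_add_two_ne (i : Fin (m + 3)) : i + 1 + 1 ≠ i := by
  rw [add_assoc, Ne, add_eq_left]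
  intro h
  have := congrArg Fin.val h
  simp [Fin.val_add, Nat.mod_eq_of_lt] at this

theorem fin_val_add_one {i k : Fin (m + 3)} (h : i < k) : (i + 1).val = i.val + 1 := by
  apply Fin.val_add_one_of_lt'
  have := k.isLt
  omega

/-- A nonempty set of cyclic indices that is closed under successor is everything. -/
theorem fin_forall_of_add_one {p : Fin (m + 3) → Prop} (h : ∀ i, p i → p (i + 1))
    {i : Fin (m + 3)} (hi : p i) (j : Fin (m + 3)) : p j := by
  have key : ∀ t : ℕ, p (i + (Fin.ofNat (m + 3) t)) := by
    intro t
    induction t with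
    | zero => simpa using hi
    | succ t ih =>
      have := h _ ih
      convert this using 1
      rw [add_assoc]
      congr 1
      ext
      simp [Fin.val_add]
  have := key (j - i).val
  simpa using this

end CyclicIndices

/-! ### Edge functionals and their orientation -/

/-- The functionals `f i` cut out the edges of the polygon with vertices `P`. -/
def IsEdgeSystem {m : ℕ} (P : Fin (m + 3) → Plane) (f : Fin (m + 3) → Fin 3 → ℝ) : Prop :=
  (∀ i, f i ⬝ᵥ hom (P i) = 0) ∧ (∀ i, f i ⬝ᵥ hom (P (i + 1)) = 0) ∧
    ∀ i k, k ≠ i → k ≠ i + 1 → 0 < f i ⬝ᵥ hom (P k)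

namespace IsEdgeSystem

variable {m : ℕ} {P : Fin (m + 3) → Plane} {f : Fin (m + 3) → Fin 3 → ℝ}

theorem nonneg (hf : IsEdgeSystem P f) (i k : Fin (m + 3)) : 0 ≤ f i ⬝ᵥ hom (P k) := by
  by_cases h1 : k = i
  · rw [h1, hf.1]
  by_cases h2 : k = i + 1
  · rw [h2, hf.2.1]
  exact (hf.2.2 i k h1 h2).le

theorem pos_two (hf : IsEdgeSystem P f) (i : Fin (m + 3)) : 0 < f i ⬝ᵥ hom (P (i + 1 + 1)) :=
  hf.2.2 _ _ (fin_add_two_ne i) (fin_add_one_ne _)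

theorem pos_succ (hf : IsEdgeSystem P f) (i : Fin (m + 3)) : 0 < f (i + 1) ⬝ᵥ hom (P i) :=
  hf.2.2 _ _ (fin_add_one_ne i).symm (fin_add_two_ne i).symm

theorem pos_pred (hf : IsEdgeSystem P f) (i : Fin (m + 3)) : 0 < f (i - 1) ⬝ᵥ hom (P (i + 1)) := by
  simpa using hf.pos_two (i - 1)

theorem smul (hf : IsEdgeSystem P f) {s : Fin (m + 3) → ℝ} (hs : ∀ i, 0 < s i) :
    IsEdgeSystem P fun i => s i • f i := by
  refine ⟨fun i => ?_, fun i => ?_, fun i k h1 h2 => ?_⟩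
  · simp [hf.1]
  · simp [hf.2.1]
  · simpa using mul_pos (hs i) (hf.2.2 i k h1 h2)

/-- The product is the determinant of the values of the functionals at the vertices. Its zeros leave
one term, the product of `f i` at vertex `i + 2`, `f (i + 1)` at vertex `i` and `f k` at vertex `i +
1`. -/
theorem det3_mul_pos (hf : IsEdgeSystem P f) {i k : Fin (m + 3)} (h1 : k ≠ i) (h2 : k ≠ i + 1) :
    0 < det3 (f i) (f (i + 1)) (f k) * det3 (hom (P i)) (hom (P (i + 1))) (hom (P (i + 1 + 1))) := by
  rw [det3_mul_det3]
  have := mul_pos (mul_pos (hf.pos_two i) (hf.pos_succ i)) (hf.2.2 k (i + 1)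
    h2.symm (fun h => h1 (add_right_cancel h).symm))
  simp only [det3, hf.1, hf.2.1, Matrix.cons_val_zero, Matrix.cons_val_one, Matrix.cons_val]
  linarith

theorem det3_vertices_ne_zero (hf : IsEdgeSystem P f) (i : Fin (m + 3)) :
    det3 (hom (P i)) (hom (P (i + 1))) (hom (P (i + 1 + 1))) ≠ 0 := fun h => by
  have := hf.det3_mul_pos (i := i) (k := i + 1 + 1) (fin_add_two_ne i) (fin_add_one_ne _)
  simp [h] at this

theorem det3_ne_zero (hf : IsEdgeSystem P f) (i : Fin (m + 3)) :
    det3 (f i) (f (i + 1)) (f (i + 1 + 1)) ≠ 0 := fun h => by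
  have := hf.det3_mul_pos (i := i) (k := i + 1 + 1) (fin_add_two_ne i) (fin_add_one_ne _)
  simp [h] at this

/-- All consecutive triples of edges have the same orientation. -/
theorem exists_orientation (hf : IsEdgeSystem P f) : ∃ κ : ℝ,
    ∀ i k, k ≠ i → k ≠ i + 1 → 0 < κ * det3 (f i) (f (i + 1)) (f k) := by
  set D : Fin (m + 3) → ℝ := fun i => det3 (hom (P i)) (hom (P (i + 1))) (hom (P (i + 1 + 1)))
  have hD : ∀ i, 0 < D 0 * D i := by
    -- `D i` and `D (i + 1)` both have the sign of the determinant of `f i`, `f (i + 1)`, `f (i +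
    -- 2)`.
    refine fin_forall_of_add_one (i := 0) (fun i hi => ?_) ?_
    · have h1 : 0 < _ * D i := hf.det3_mul_pos (i := i) (k := i + 1 + 1) (fin_add_two_ne i)
        (fin_add_one_ne _)
      have h2 : 0 < _ * D (i + 1) := hf.det3_mul_pos (i := i + 1) (k := i)
        (fin_add_one_ne i).symm (fin_add_two_ne i).symm
      rw [det3_rotate] at h2
      have h3 := mul_pos (mul_pos h1 h2) hi
      set d := det3 (f i) (f (i + 1)) (f (i + 1 + 1))
      have h4 : d * D i * (d * D (i + 1)) * (D 0 * D i) =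
        (d * D i) ^ 2 * (D 0 * D (i + 1)) := by ring
      rw [h4] at h3
      exact pos_of_mul_pos_right h3 (sq_nonneg _)
    · exact mul_self_pos.2 (hf.det3_vertices_ne_zero 0)
  refine ⟨D 0, fun i k h1 h2 => ?_⟩
  have h3 := mul_pos (hD i) (hf.det3_mul_pos h1 h2)
  have h4 : D 0 * D i * (det3 (f i) (f (i + 1)) (f k) * D i) =
    (D i) ^ 2 * (D 0 * det3 (f i) (f (i + 1)) (f k)) := by ring
  change 0 < D 0 * D i * (det3 (f i) (f (i + 1)) (f k) * D i) at h3
  rw [h4] at h3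
  exact pos_of_mul_pos_right h3 (sq_nonneg _)

/-- The edge functionals are cyclically ordered. -/
theorem exists_orientation_of_lt (hf : IsEdgeSystem P f) : ∃ κ : ℝ,
    ∀ i j k, i < j → j < k → 0 < κ * det3 (f i) (f j) (f k) := by
  obtain ⟨κ, hκ⟩ := hf.exists_orientation
  refine ⟨κ, ?_⟩
  -- Induction on the gap `k - j`. The Plücker relation for `i + 1, j, j + 1, k` seen from `i`
  -- expresses the wanted sign through triples containing two neighbours and one triple with a
  -- smaller gap.
  have key : ∀ t : ℕ, ∀ i j k : Fin (m + 3), i < j → j < k → k.val - j.val = t + 1 →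
      0 < κ * det3 (f i) (f j) (f k) := by
    intro t
    induction t with
    | zero =>
      intro i j k hij hjk ht
      have hk : k = j + 1 := by
        ext; rw [fin_val_add_one hjk]; omega
      subst hk
      rw [← det3_rotate]
      exact hκ j i hij.ne (hij.trans hjk).ne
    | succ t ih =>
      intro i j k hij hjk ht
      have hik := hij.trans hjk
      have hi1 := fin_val_add_one hij
      have hj1 := fin_val_add_one hjk
      by_cases hj : j = i + 1
      · rw [hj]
        refine hκ i k hik.ne' fun h => ?_
        rw [h, ← hj] at hjk
        exact hjk.false
      have hlt : j < j + 1 := by rw [Fin.lt_def]; omega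
      have hlt2 : j + 1 < k := by rw [Fin.lt_def]; omega
      have e1 := hκ i j hij.ne' hj
      have e2 := ih i (j + 1) k (hij.trans hlt) hlt2 (by omega)
      have e3 := hκ i k hik.ne' fun h => by
        have := congrArg Fin.val h; rw [Fin.lt_def] at hij hjk; omega
      have e4 := hκ j i hij.ne (hij.trans hlt).ne
      have e5 := hκ i (j + 1) (hij.trans hlt).ne' fun h => hij.ne' (add_right_cancel h)
      rw [det3_rotate] at e4
      have hp := det3_pluecker (f i) (f (i + 1)) (f j) (f (j + 1)) (f k)
      have : 0 < (κ * det3 (f i) (f j) (f k)) * (κ * det3 (f i) (f (i + 1)) (f (j + 1))) := by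
        have := add_pos (mul_pos e1 e2) (mul_pos e3 e4)
        calc _ < _ := this
          _ = _ := by linear_combination (-κ ^ 2) * hp
      exact pos_of_mul_pos_left this e5.le
  intro i j k hij hjk
  exact key (k.val - j.val - 1) i j k hij hjk (by rw [Fin.lt_def] at hjk; omega)

/-- A linear functional is maximized over the polygon at a vertex, where it is a nonpositive
combination of the two edge functionals. -/
theorem exists_vertex (hf : IsEdgeSystem P f) (g : Fin 3 → ℝ) :
    ∃ k : Fin (m + 3), ∃ α β : ℝ, 0 ≤ α ∧ 0 ≤ β ∧ ∀ v : Fin 3 → ℝ,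
      g ⬝ᵥ v - (g ⬝ᵥ hom (P k)) * v 2 = -α * (f (k - 1) ⬝ᵥ v) - β * (f k ⬝ᵥ v) := by
  obtain ⟨k, -, hk⟩ := Finset.exists_max_image Finset.univ (fun k => g ⬝ᵥ hom (P k))
    ⟨0, Finset.mem_univ _⟩
  replace hk := fun j => hk j (Finset.mem_univ _)
  obtain ⟨i, rfl⟩ : ∃ i, k = i + 1 := ⟨k - 1, by simp⟩
  have h1 := hf.pos_two i
  have h2 := hf.pos_succ i
  set c := g ⬝ᵥ hom (P (i + 1))
  set α := (c - g ⬝ᵥ hom (P (i + 1 + 1))) / (f i ⬝ᵥ hom (P (i + 1 + 1)))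
  set β := (c - g ⬝ᵥ hom (P i)) / (f (i + 1) ⬝ᵥ hom (P i))
  have hhom : ∀ x, hom x 2 = 1 := fun x => by simp [hom]
  -- An affine functional vanishing at three consecutive vertices is zero; `α` and `β` are chosen to
  -- make it vanish at the outer two.
  have hz : g - c • ![0, 0, 1] + α • f i + β • f (i + 1) = 0 := by
    have h3 : ∀ v : Fin 3 → ℝ, ![0, 0, 1] ⬝ᵥ v = v 2 := fun v => by
      simp [dotProduct, Fin.sum_univ_three]
    apply det3_transpose_eq_zero (hf.det3_vertices_ne_zero i)
    · simp only [add_dotProduct, sub_dotProduct, smul_dotProduct, smul_eq_mul, hf.1, h3, hhom, β]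
      field_simp
      ring
    · simp only [add_dotProduct, sub_dotProduct, smul_dotProduct, smul_eq_mul, hf.1, hf.2.1, h3,
        hhom]
      ring
    · simp only [add_dotProduct, sub_dotProduct, smul_dotProduct, smul_eq_mul, hf.2.1, h3, hhom, α]
      field_simp
      ring
  refine ⟨i + 1, α, β, div_nonneg (sub_nonneg.2 (hk _)) h1.le, div_nonneg (sub_nonneg.2 (hk _)) h2.le,
    fun v => ?_⟩
  have := congrArg (· ⬝ᵥ v) hz
  simp only [add_dotProduct, sub_dotProduct, smul_dotProduct, smul_eq_mul, zero_dotProduct] at this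
  have h3 : ![0, 0, 1] ⬝ᵥ v = v 2 := by simp [dotProduct, Fin.sum_univ_three]
  rw [h3] at this
  rw [add_sub_cancel_right]
  linarith

end IsEdgeSystem

/-! ### Edge functionals of a convex polygon -/

/-- The twice signed area functional of the directed line through `p` and `q`. -/
def lineFunctional (p q : Plane) : Fin 3 → ℝ :=
  ![p 1 - q 1, q 0 - p 0, p 0 * q 1 - p 1 * q 0]

theorem lineFunctional_dot (p q x : Plane) :
    lineFunctional p q ⬝ᵥ hom x = (q 0 - p 0) * (x 1 - p 1) - (q 1 - p 1) * (x 0 - p 0) := by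
  rw [dot_hom]
  simp [lineFunctional]
  ring

theorem mem_line_of_dot_eq_zero {p q x : Plane} (hpq : p ≠ q)
    (h : lineFunctional p q ⬝ᵥ hom x = 0) : x ∈ line[ℝ, p, q] := by
  rw [lineFunctional_dot] at h
  have key : ∃ t : ℝ, x = AffineMap.lineMap p q t := by
    by_cases h0 : q 0 - p 0 = 0
    · have h1 : q 1 - p 1 ≠ 0 := fun h1 => hpq <| by
        ext i
        fin_cases i
        · simp; linarith
        · simp; linarith
      refine ⟨(x 1 - p 1) / (q 1 - p 1), ?_⟩
      have hx : x 0 - p 0 = 0 := by simpa [h0, h1] using h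
      ext i
      fin_cases i
      · simp [AffineMap.lineMap_apply, h0]; linarith
      · simp [AffineMap.lineMap_apply]; field_simp; ring
    · refine ⟨(x 0 - p 0) / (q 0 - p 0), ?_⟩
      ext i
      fin_cases i
      · simp [AffineMap.lineMap_apply]; field_simp; ring
      · simp [AffineMap.lineMap_apply]; field_simp; linarith
  obtain ⟨t, rfl⟩ := key
  exact AffineMap.lineMap_mem_affineSpan_pair t p q

theorem dot_eq_zero_of_mem_line {p q x : Plane} (h : x ∈ line[ℝ, p, q]) :
    lineFunctional p q ⬝ᵥ hom x = 0 := by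
  obtain ⟨t, rfl⟩ := mem_affineSpan_pair_iff_exists_lineMap_eq.1 h
  rw [lineFunctional_dot]
  simp [AffineMap.lineMap_apply]
  ring

theorem sSameSide_dot_pos {p q x y : Plane} (hpq : p ≠ q) (h : (line[ℝ, p, q]).SSameSide x y) :
    0 < (lineFunctional p q ⬝ᵥ hom x) * (lineFunctional p q ⬝ᵥ hom y) := by
  obtain ⟨⟨p₁, hp₁, p₂, hp₂, hr⟩, hx, hy⟩ := h
  have hx' : lineFunctional p q ⬝ᵥ hom x ≠ 0 := fun h => hx (mem_line_of_dot_eq_zero hpq h)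
  have hy' : lineFunctional p q ⬝ᵥ hom y ≠ 0 := fun h => hy (mem_line_of_dot_eq_zero hpq h)
  have hlin : ∀ x p₁ : Plane, p₁ ∈ line[ℝ, p, q] → lineFunctional p q ⬝ᵥ hom x =
      (lineFunctional p q) 0 * (x -ᵥ p₁) 0 + (lineFunctional p q) 1 * (x -ᵥ p₁) 1 := by
    intro x p₁ hp₁
    have := dot_eq_zero_of_mem_line hp₁
    rw [dot_hom] at this ⊢
    simp
    linarith
  rcases hr with h0 | h0 | ⟨r₁, r₂, hr₁, hr₂, h0⟩
  · exact absurd (by rw [hlin x p₁ hp₁, h0]; simp) hx'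
  · exact absurd (by rw [hlin y p₂ hp₂, h0]; simp) hy'
  · have e : r₁ * (lineFunctional p q ⬝ᵥ hom x) = r₂ * (lineFunctional p q ⬝ᵥ hom y) := by
      rw [hlin x p₁ hp₁, hlin y p₂ hp₂]
      have e0 := congrArg (fun v : Plane => v 0) h0
      have e1 := congrArg (fun v : Plane => v 1) h0
      simp only [PiLp.smul_apply, smul_eq_mul] at e0 e1
      linear_combination (lineFunctional p q 0) * e0 + (lineFunctional p q 1) * e1
    have h2 : 0 < r₂ * (lineFunctional p q ⬝ᵥ hom y) * (lineFunctional p q ⬝ᵥ hom y) := by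
      rw [mul_assoc]; exact mul_pos hr₂ (mul_self_pos.2 hy')
    rw [← e, mul_assoc] at h2
    exact pos_of_mul_pos_right h2 hr₁.le

theorem Polygon.IsConvex.exists_isEdgeSystem {m : ℕ} {P : Polygon Plane (m + 3)}
    (hP : P.IsConvex) : ∃ f, IsEdgeSystem P.vertices f := by
  have hP2 := hP.2
  simp only [finRotate_apply] at hP2
  have hne : ∀ i, P i ≠ P (i + 1) := fun i h => by
    have := hP2 (i + 1) i i (fin_add_one_ne i).symm (fin_add_two_ne i).symm
      (fin_add_one_ne i).symm (fin_add_two_ne i).symm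
    apply this.2.1
    rw [h]
    exact left_mem_affineSpan_pair ℝ _ _
  -- The factor, its own value at the next vertex, makes the functional positive whatever the
  -- orientation of the polygon.
  refine ⟨fun i => (lineFunctional (P i) (P (i + 1)) ⬝ᵥ hom (P (i + 1 + 1))) •
    lineFunctional (P i) (P (i + 1)), fun i => ?_, fun i => ?_, fun i k h1 h2 => ?_⟩
  · rw [smul_dotProduct, dot_eq_zero_of_mem_line (left_mem_affineSpan_pair ℝ _ _), smul_zero]
  · rw [smul_dotProduct, dot_eq_zero_of_mem_line (right_mem_affineSpan_pair ℝ _ _), smul_zero]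
  · rw [smul_dotProduct, smul_eq_mul]
    exact sSameSide_dot_pos (hne i)
      (hP2 i (i + 1 + 1) k (fin_add_two_ne i) (fin_add_one_ne _) h1 h2)

/-! ### Affine functionals and the region of the polygon -/

theorem dot_hom_lineMap (u : Fin 3 → ℝ) (x y : Plane) (t : ℝ) :
    u ⬝ᵥ hom (AffineMap.lineMap x y t) = (1 - t) * (u ⬝ᵥ hom x) + t * (u ⬝ᵥ hom y) := by
  simp only [dot_hom, AffineMap.lineMap_apply]
  simp
  ring

theorem continuous_dot_hom (u : Fin 3 → ℝ) : Continuous fun x : Plane => u ⬝ᵥ hom x := by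
  simp only [dot_hom]
  fun_prop

theorem convex_dot_hom_le (u v : Fin 3 → ℝ) :
    Convex ℝ {x : Plane | u ⬝ᵥ hom x ≤ v ⬝ᵥ hom x} := by
  intro x hx y hy a b ha hb hab
  simp only [Set.mem_ofPred_eq, dot_hom] at hx hy ⊢
  simp
  have h1 := mul_le_mul_of_nonneg_left hx ha
  have h2 := mul_le_mul_of_nonneg_left hy hb
  have h3 : ∀ w : Fin 3 → ℝ, w 0 * (a * x 0 + b * y 0) + w 1 * (a * x 1 + b * y 1) + w 2 =
    a * (w 0 * x 0 + w 1 * x 1 + w 2) + b * (w 0 * y 0 + w 1 * y 1 + w 2) := fun w => by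
    linear_combination (-w 2) * hab
  rw [h3 u, h3 v]
  linarith

/-- The vector of coefficients of the linear part of an affine functional. -/
noncomputable def linearPart (u : Fin 3 → ℝ) : Plane := !₂[u 0, u 1]

theorem inner_linearPart (u : Fin 3 → ℝ) (x : Plane) :
    inner ℝ (linearPart u) x = u ⬝ᵥ hom x - u 2 := by
  rw [dot_hom]
  simp [linearPart, PiLp.inner_apply, Fin.sum_univ_two]
  ring

/-- The functional that vanishes at the vertex `i + 1` and on the next edge, and is `1` at the
vertex `i`. -/
noncomputable def leftCoord {m : ℕ} (P : Polygon Plane (m + 3)) (f : Fin (m + 3) → Fin 3 → ℝ)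
    (i : Fin (m + 3)) : Fin 3 → ℝ :=
  (f (i + 1) ⬝ᵥ hom (P.vertices i))⁻¹ • f (i + 1)

/-- The functional that vanishes at the vertex `i` and on the previous edge, and is `1` at the
vertex `i + 1`. -/
noncomputable def rightCoord {m : ℕ} (P : Polygon Plane (m + 3)) (f : Fin (m + 3) → Fin 3 → ℝ)
    (i : Fin (m + 3)) : Fin 3 → ℝ :=
  (f (i - 1) ⬝ᵥ hom (P.vertices (i + 1)))⁻¹ • f (i - 1)

/-- The affine functional that interpolates the heights `h` along the edge `i`. -/
noncomputable def interp {m : ℕ} (P : Polygon Plane (m + 3)) (f : Fin (m + 3) → Fin 3 → ℝ)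
    (h : Fin (m + 3) → ℝ) (i : Fin (m + 3)) : Fin 3 → ℝ :=
  h i • leftCoord P f i + h (i + 1) • rightCoord P f i

namespace IsEdgeSystem

variable {m : ℕ} {P : Polygon Plane (m + 3)} {f : Fin (m + 3) → Fin 3 → ℝ}

/-- A functional separating a point from the hull is maximal at some vertex, where `exists_vertex`
bounds it on the intersection of half-planes by its value at that vertex. -/
theorem region_eq (hf : IsEdgeSystem P.vertices f) :
    P.region = {x | ∀ i, 0 ≤ f i ⬝ᵥ hom x} := by
  apply Set.Subset.antisymm
  · refine convexHull_min ?_ ?_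
    · rintro _ ⟨k, rfl⟩ i
      exact hf.nonneg i k
    · have : {x : Plane | ∀ i, 0 ≤ f i ⬝ᵥ hom x} = ⋂ i, {x | (0 : Fin 3 → ℝ) ⬝ᵥ hom x ≤ f i ⬝ᵥ hom x} := by
        ext; simp
      rw [this]
      exact convex_iInter fun i => convex_dot_hom_le _ _
  · intro x hx
    by_contra hxn
    have hcl : IsClosed P.region := (Set.finite_range _).isClosed_convexHull (𝕜 := ℝ)
    obtain ⟨l, c, hl, hc⟩ := geometric_hahn_banach_closed_point (convex_convexHull ℝ _) hcl hxn
    set g : Fin 3 → ℝ := ![l (EuclideanSpace.single 0 1), l (EuclideanSpace.single 1 1), 0]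
    have hg : ∀ y : Plane, g ⬝ᵥ hom y = l y := by
      intro y
      have : y = y 0 • EuclideanSpace.single 0 1 + y 1 • EuclideanSpace.single 1 1 := by
        ext i; fin_cases i <;> simp
      conv_rhs => rw [this]
      rw [dot_hom, map_add, map_smul, map_smul]
      simp [g]
      ring
    obtain ⟨k, α, β, hα, hβ, h⟩ := hf.exists_vertex g
    have h1 := h (hom x)
    rw [hg, hg] at h1
    have h2 := hl (P.vertices k) (subset_convexHull ℝ _ ⟨k, rfl⟩)
    have h3 := mul_nonneg hα (hx (k - 1))
    have h4 := mul_nonneg hβ (hx k)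
    have h5 : hom x 2 = 1 := by simp [hom]
    rw [h5] at h1
    linarith

theorem isBounded_region : Bornology.IsBounded P.region :=
  ((Set.finite_range _).isCompact_convexHull (𝕜 := ℝ)).isBounded

theorem dot_pos_of_mem_interior (hf : IsEdgeSystem P.vertices f) {x : Plane}
    (hx : x ∈ interior P.region) (i : Fin (m + 3)) : 0 < f i ⬝ᵥ hom x := by
  have hmem := interior_subset hx
  rw [hf.region_eq] at hmem
  refine lt_of_le_of_ne (hmem i) fun h0 => ?_
  have hlm : Filter.Tendsto (fun t : ℝ => AffineMap.lineMap x (P.vertices (i + 1 + 1)) t)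
      (nhds 0) (nhds x) := by
    have : Continuous fun t : ℝ => AffineMap.lineMap x (P.vertices (i + 1 + 1)) t :=
      AffineMap.lineMap_continuous
    simpa using this.tendsto 0
  have hev := hlm.eventually (mem_interior_iff_mem_nhds.1 hx)
  obtain ⟨ε, hε, h⟩ := Metric.eventually_nhds_iff.1 hev
  -- The negative parameter moves away from vertex `i + 2`, making `f i` negative.
  have h1 : _ ∈ P.region := h (y := -(ε / 2)) (by simp [abs_of_pos hε]; linarith)
  rw [hf.region_eq] at h1
  have h2 := h1 i
  rw [dot_hom_lineMap, ← h0] at h2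
  have h3 := mul_pos hε (hf.pos_two i)
  linarith

theorem exists_forall_pos (hf : IsEdgeSystem P.vertices f) : ∃ z, ∀ i, 0 < f i ⬝ᵥ hom z := by
  refine ⟨((m + 3 : ℕ) : ℝ)⁻¹ • ∑ k, P.vertices k, fun i => ?_⟩
  have h : f i ⬝ᵥ hom (((m + 3 : ℕ) : ℝ)⁻¹ • ∑ k, P.vertices k) =
      ((m + 3 : ℕ) : ℝ)⁻¹ * ∑ k, f i ⬝ᵥ hom (P.vertices k) := by
    simp only [dot_hom, Finset.sum_add_distrib, ← Finset.mul_sum]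
    simp
    field_simp
  rw [h]
  refine mul_pos (by positivity) ?_
  exact Finset.sum_pos' (fun k _ => hf.nonneg i k) ⟨i + 1 + 1, Finset.mem_univ _, hf.pos_two i⟩

/-- The functionals of edges `i - 1`, `i`, `i + 1` are independent and agree on both sides. Here `v`
need not represent a point. -/
theorem eq_add_of_dot_eq_zero (hf : IsEdgeSystem P.vertices f) {i : Fin (m + 3)} {v : Fin 3 → ℝ}
    (h0 : f i ⬝ᵥ v = 0) :
    v = (leftCoord P f i ⬝ᵥ v) • hom (P.vertices i) +
      (rightCoord P f i ⬝ᵥ v) • hom (P.vertices (i + 1)) := by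
  have h1 := hf.pos_succ i
  have h2 := hf.pos_pred i
  have h3 := hf.2.1 (i - 1)
  have hd := hf.det3_ne_zero (i - 1)
  rw [sub_add_cancel] at h3 hd
  rw [← sub_eq_zero]
  apply eq_zero_of_dot_eq_zero hd <;>
  simp only [dotProduct_sub, dotProduct_add, dotProduct_smul, smul_dotProduct, smul_eq_mul, h3, h0,
    hf.1, hf.2.1, leftCoord, rightCoord]
  · field_simp; ring
  · ring
  · field_simp; ring

/-- A point of the region on which the edge functional vanishes is on the edge. -/
theorem mem_edgeSet_of_dot_eq_zero (hf : IsEdgeSystem P.vertices f) {i : Fin (m + 3)} {x : Plane}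
    (hx : x ∈ P.region) (h0 : f i ⬝ᵥ hom x = 0) : x ∈ P.edgeSet ℝ i := by
  rw [hf.region_eq] at hx
  have hz := hf.eq_add_of_dot_eq_zero h0
  set α := leftCoord P f i ⬝ᵥ hom x with hα'
  set β := rightCoord P f i ⬝ᵥ hom x with hβ'
  have hα : 0 ≤ α := by
    rw [hα', leftCoord, smul_dotProduct]
    exact mul_nonneg (inv_nonneg.2 (hf.nonneg _ _)) (hx _)
  have hβ : 0 ≤ β := by
    rw [hβ', rightCoord, smul_dotProduct]
    exact mul_nonneg (inv_nonneg.2 (hf.nonneg _ _)) (hx _)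
  have e2 := congrFun hz 2
  have e0 := congrFun hz 0
  have e1 := congrFun hz 1
  simp [hom] at e0 e1 e2
  refine ⟨β, ⟨hβ, by linarith⟩, ?_⟩
  rw [finRotate_apply]
  ext j
  fin_cases j
  · simp [AffineMap.lineMap_apply]
    linear_combination P.vertices i 0 * e2 - e0
  · simp [AffineMap.lineMap_apply]
    linear_combination P.vertices i 1 * e2 - e1

end IsEdgeSystem

/-! ### Cells of compatible functionals -/

/-- The part of the polygon on which `φ i` is the smallest of the functionals `φ j`. -/
def cell {m : ℕ} (P : Polygon Plane (m + 3)) (φ : Fin (m + 3) → Fin 3 → ℝ) (i : Fin (m + 3)) :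
    Set Plane :=
  {x | x ∈ P.region ∧ ∀ j, φ i ⬝ᵥ hom x ≤ φ j ⬝ᵥ hom x}

/-- Affine functionals that agree along the edges of a polygon so that each edge lies in the cell
of its functional. -/
structure IsCompatible {m : ℕ} (P : Polygon Plane (m + 3)) (φ : Fin (m + 3) → Fin 3 → ℝ) :
    Prop where
  eq : ∀ i, φ (i + 1) ⬝ᵥ hom (P.vertices (i + 1)) = φ i ⬝ᵥ hom (P.vertices (i + 1))
  lt : ∀ i j, j ≠ i → j ≠ i + 1 →
    φ i ⬝ᵥ hom (P.vertices (i + 1)) < φ j ⬝ᵥ hom (P.vertices (i + 1))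

namespace IsCompatible

variable {m : ℕ} {P : Polygon Plane (m + 3)} {f φ : Fin (m + 3) → Fin 3 → ℝ}

theorem lt_left (hφ : IsCompatible P φ) {i j : Fin (m + 3)} (h1 : j ≠ i) (h2 : j ≠ i - 1) :
    φ i ⬝ᵥ hom (P.vertices i) < φ j ⬝ᵥ hom (P.vertices i) := by
  have e := hφ.eq (i - 1)
  have l := hφ.lt (i - 1) j h2
  rw [sub_add_cancel] at e l
  rw [e]
  exact l h1

theorem le_left (hφ : IsCompatible P φ) (i j : Fin (m + 3)) :
    φ i ⬝ᵥ hom (P.vertices i) ≤ φ j ⬝ᵥ hom (P.vertices i) := by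
  by_cases h1 : j = i
  · rw [h1]
  by_cases h2 : j = i - 1
  · have e := hφ.eq (i - 1)
    rw [sub_add_cancel] at e
    rw [h2, e]
  exact (hφ.lt_left h1 h2).le

theorem le_right (hφ : IsCompatible P φ) (i j : Fin (m + 3)) :
    φ i ⬝ᵥ hom (P.vertices (i + 1)) ≤ φ j ⬝ᵥ hom (P.vertices (i + 1)) := by
  by_cases h1 : j = i
  · rw [h1]
  by_cases h2 : j = i + 1
  · rw [h2, hφ.eq]
  exact (hφ.lt i j h1 h2).le

theorem dot_midpoint (u : Fin 3 → ℝ) (x y : Plane) :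
    u ⬝ᵥ hom (midpoint ℝ x y) = (u ⬝ᵥ hom x + u ⬝ᵥ hom y) / 2 := by
  rw [midpoint, dot_hom_lineMap]
  norm_num
  ring

/-- Only `i - 1` can tie with `i` at the left end and only `i + 1` at the right end. These differ,
so one end is strict. -/
theorem lt_midpoint (hφ : IsCompatible P φ) {i j : Fin (m + 3)} (h : j ≠ i) :
    φ i ⬝ᵥ hom (midpoint ℝ (P.vertices i) (P.vertices (i + 1))) <
      φ j ⬝ᵥ hom (midpoint ℝ (P.vertices i) (P.vertices (i + 1))) := by
  rw [dot_midpoint, dot_midpoint]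
  have hl := hφ.le_left i j
  have hr := hφ.le_right i j
  by_cases h2 : j = i + 1
  · have := hφ.lt_left (i := i) (j := j) h fun h3 => by
      have := fin_add_two_ne (i - 1)
      rw [sub_add_cancel, ← h2] at this
      exact this h3
    linarith
  · have := hφ.lt i j h h2
    linarith

theorem iUnion_cell : ⋃ i, cell P φ i = P.region := by
  apply Set.Subset.antisymm
  · exact Set.iUnion_subset fun i x hx => hx.1
  · intro x hx
    obtain ⟨i, -, hi⟩ := Finset.exists_min_image Finset.univ (fun j => φ j ⬝ᵥ hom x)
      ⟨0, Finset.mem_univ _⟩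
    exact Set.mem_iUnion.2 ⟨i, hx, fun j => hi j (Finset.mem_univ _)⟩

theorem dot_eq_of_isOpen {u v : Fin 3 → ℝ} {U : Set Plane} (hU : IsOpen U) (hne : U.Nonempty)
    (h : ∀ x ∈ U, u ⬝ᵥ hom x = v ⬝ᵥ hom x) (y : Plane) : u ⬝ᵥ hom y = v ⬝ᵥ hom y := by
  obtain ⟨x, hx⟩ := hne
  have hlm : Filter.Tendsto (fun t : ℝ => AffineMap.lineMap x y t) (nhds 0) (nhds x) := by
    have : Continuous fun t : ℝ => AffineMap.lineMap x y t := AffineMap.lineMap_continuous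
    simpa using this.tendsto 0
  obtain ⟨ε, hε, hb⟩ := Metric.eventually_nhds_iff.1 (hlm.eventually (hU.mem_nhds hx))
  have h1 := h _ (hb (y := ε / 2) (by simp [abs_of_pos hε]; linarith))
  rw [dot_hom_lineMap, dot_hom_lineMap, h x hx] at h1
  have : ε / 2 * (u ⬝ᵥ hom y) = ε / 2 * (v ⬝ᵥ hom y) := by linarith
  exact mul_left_cancel₀ (by positivity) this

theorem disjoint_interior_cell (hφ : IsCompatible P φ) {i j : Fin (m + 3)} (hij : i ≠ j) :
    Disjoint (interior (cell P φ i)) (interior (cell P φ j)) := by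
  rw [Set.disjoint_iff_inter_eq_empty]
  by_contra hne
  have := dot_eq_of_isOpen (isOpen_interior.inter isOpen_interior)
    (Set.nonempty_iff_ne_empty.2 hne)
    (fun x hx => le_antisymm ((interior_subset hx.1).2 j) ((interior_subset hx.2).2 i))
    (midpoint ℝ (P.vertices i) (P.vertices (i + 1)))
  exact (hφ.lt_midpoint hij.symm).ne this

theorem convex_cell (i : Fin (m + 3)) : Convex ℝ (cell P φ i) := by
  have : cell P φ i = P.region ∩ ⋂ j, {x | φ i ⬝ᵥ hom x ≤ φ j ⬝ᵥ hom x} := by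
    ext; simp [cell]
  rw [this]
  exact (convex_convexHull ℝ _).inter (convex_iInter fun j => convex_dot_hom_le _ _)

theorem isClosed_cell (i : Fin (m + 3)) : IsClosed (cell P φ i) := by
  have : cell P φ i = P.region ∩ ⋂ j, {x | φ i ⬝ᵥ hom x ≤ φ j ⬝ᵥ hom x} := by
    ext; simp [cell]
  rw [this]
  exact ((Set.finite_range _).isClosed_convexHull (𝕜 := ℝ)).inter
    (isClosed_iInter fun j => isClosed_le (continuous_dot_hom _) (continuous_dot_hom _))

theorem mem_interior_cell (hf : IsEdgeSystem P.vertices f) {i : Fin (m + 3)} {x : Plane}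
    (hx : ∀ j, 0 < f j ⬝ᵥ hom x) (h : ∀ j, j ≠ i → φ i ⬝ᵥ hom x < φ j ⬝ᵥ hom x) :
    x ∈ interior (cell P φ i) := by
  rw [mem_interior]
  refine ⟨(⋂ j, {x | 0 < f j ⬝ᵥ hom x}) ∩ ⋂ j, {x | j ≠ i → φ i ⬝ᵥ hom x < φ j ⬝ᵥ hom x},
    ?_, ?_, ?_⟩
  · rintro y ⟨h1, h2⟩
    simp only [Set.mem_iInter, Set.mem_ofPred_eq] at h1 h2
    refine ⟨?_, fun j => ?_⟩
    · rw [hf.region_eq]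
      exact fun j => (h1 j).le
    · by_cases hj : j = i
      · rw [hj]
      · exact (h2 j hj).le
  · refine (isOpen_iInter_of_finite fun j => isOpen_lt continuous_const (continuous_dot_hom _)).inter
      (isOpen_iInter_of_finite fun j => ?_)
    by_cases hj : j = i
    · simp [hj]
    · simpa [hj] using isOpen_lt (continuous_dot_hom _) (continuous_dot_hom _)
  · simp only [Set.mem_inter_iff, Set.mem_iInter, Set.mem_ofPred_eq]
    exact ⟨hx, h⟩

theorem interior_cell_nonempty (hf : IsEdgeSystem P.vertices f) (hφ : IsCompatible P φ)
    (i : Fin (m + 3)) : (interior (cell P φ i)).Nonempty := by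
  obtain ⟨z, hz⟩ := hf.exists_forall_pos
  set M := midpoint ℝ (P.vertices i) (P.vertices (i + 1))
  have hM : ∀ j, 0 ≤ f j ⬝ᵥ hom M := fun j => by
    rw [dot_midpoint]
    have := hf.nonneg j i
    have := hf.nonneg j (i + 1)
    positivity
  have hlm : Filter.Tendsto (fun t : ℝ => AffineMap.lineMap M z t) (nhdsWithin 0 (Set.Ioi 0))
      (nhds M) := by
    have : Continuous fun t : ℝ => AffineMap.lineMap M z t := AffineMap.lineMap_continuous
    simpa using (this.tendsto 0).mono_left nhdsWithin_le_nhds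
  have h1 : ∀ᶠ t : ℝ in nhdsWithin 0 (Set.Ioi 0), ∀ j, j ≠ i →
      φ i ⬝ᵥ hom (AffineMap.lineMap M z t) < φ j ⬝ᵥ hom (AffineMap.lineMap M z t) := by
    rw [Filter.eventually_all]
    intro j
    by_cases hj : j = i
    · simp [hj]
    simp only [ne_eq, hj, not_false_eq_true, forall_true_left]
    exact hlm.eventually ((isOpen_lt (continuous_dot_hom (φ i)) (continuous_dot_hom (φ j))).mem_nhds
      (hφ.lt_midpoint hj))
  have h2 : ∀ᶠ t : ℝ in nhdsWithin 0 (Set.Ioi 0), t ∈ Set.Ioo (0 : ℝ) 1 :=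
    Ioo_mem_nhdsGT one_pos
  obtain ⟨t, ht1, ht2⟩ := (h1.and h2).exists
  refine ⟨_, mem_interior_cell hf (fun j => ?_) ht1⟩
  rw [dot_hom_lineMap]
  have := mul_nonneg (sub_nonneg.2 ht2.2.le) (hM j)
  have := mul_pos ht2.1 (hz j)
  linarith

theorem isConvexPolygonalRegion_cell (hf : IsEdgeSystem P.vertices f) (hφ : IsCompatible P φ)
    (i : Fin (m + 3)) : IsConvexPolygonalRegion (cell P φ i) := by
  classical
  refine ⟨IsEdgeSystem.isBounded_region.subset fun x hx => hx.1,
    interior_cell_nonempty hf hφ i, ?_⟩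
  refine ⟨Finset.univ.image (fun j => (linearPart (-f j), f j 2)) ∪
    Finset.univ.image (fun j => (linearPart (φ i - φ j), (φ j - φ i) 2)), ?_⟩
  ext x
  simp only [cell, hf.region_eq, Set.mem_ofPred_eq, Finset.mem_union, Finset.mem_image,
    Finset.mem_univ, true_and, or_imp, forall_and, forall_exists_index, forall_apply_eq_imp_iff,
    inner_linearPart, neg_dotProduct, sub_dotProduct, Pi.neg_apply, Pi.sub_apply]
  refine and_congr (forall_congr' fun j => ?_) (forall_congr' fun j => ?_)
  · constructor <;> intro h <;> linarith
  · constructor <;> intro h <;> linarith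

theorem isExposed_edgeSet (hf : IsEdgeSystem P.vertices f) (hφ : IsCompatible P φ)
    (i : Fin (m + 3)) : IsExposed ℝ (cell P φ i) (P.edgeSet ℝ i) := by
  intro _
  have hsub : P.edgeSet ℝ i ⊆ cell P φ i := by
    have hl : P.vertices i ∈ cell P φ i := ⟨subset_convexHull ℝ _ ⟨i, rfl⟩, hφ.le_left i⟩
    have hr : P.vertices (i + 1) ∈ cell P φ i :=
      ⟨subset_convexHull ℝ _ ⟨i + 1, rfl⟩, hφ.le_right i⟩
    rw [Polygon.edgeSet, finRotate_apply, affineSegment_eq_segment]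
    exact (convex_cell i).segment_subset hl hr
  have hzero : ∀ x ∈ P.edgeSet ℝ i, f i ⬝ᵥ hom x = 0 := by
    rintro _ ⟨t, -, rfl⟩
    rw [dot_hom_lineMap, finRotate_apply, hf.1, hf.2.1]
    ring
  refine ⟨innerSL ℝ (linearPart (-f i)), ?_⟩
  have hl : ∀ x, innerSL ℝ (linearPart (-f i)) x = f i 2 - f i ⬝ᵥ hom x := fun x => by
    rw [innerSL_apply_apply, inner_linearPart, neg_dotProduct, Pi.neg_apply]
    ring
  ext x
  constructor
  · intro hx
    refine ⟨hsub hx, fun y hy => ?_⟩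
    have := hy.1
    rw [hf.region_eq] at this
    rw [hl, hl, hzero x hx]
    have := this i
    linarith
  · rintro ⟨hx, hmax⟩
    have hP : P.vertices i ∈ P.edgeSet ℝ i := left_mem_affineSegment _ _ _
    have h1 := hmax _ (hsub hP)
    rw [hl, hl, hzero _ hP] at h1
    have h2 := hx.1
    rw [hf.region_eq] at h2
    exact hf.mem_edgeSet_of_dot_eq_zero hx.1 (le_antisymm (by linarith) (h2 i))

end IsCompatible

/-- Compatible functionals whose minima at the points of `A` are attained only once give a
partition of the polygon with the numbers of points given by the argmins. -/
theorem exists_partition_of_isCompatible {m : ℕ} {P : Polygon Plane (m + 3)}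
    {f φ : Fin (m + 3) → Fin 3 → ℝ} (hf : IsEdgeSystem P.vertices f) (hφ : IsCompatible P φ)
    {A : Finset Plane} (hA : (A : Set Plane) ⊆ interior P.region) {c : Fin (m + 3) → ℕ}
    (σ : A → Fin (m + 3)) (hσ : ∀ i, (Finset.univ.filter fun a => σ a = i).card = c i)
    (h : ∀ a j, j ≠ σ a → φ (σ a) ⬝ᵥ hom a < φ j ⬝ᵥ hom a) :
    ∃ R : Fin (m + 3) → Set Plane,
      (⋃ i, R i) = P.region ∧
      (∀ i j, i ≠ j → Disjoint (interior (R i)) (interior (R j))) ∧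
      ∀ i,
        Convex ℝ (R i) ∧
        IsConvexPolygonalRegion (R i) ∧
        IsExposed ℝ (R i) (P.edgeSet ℝ i) ∧
        (∀ a ∈ A, a ∉ frontier (R i)) ∧
        ((A : Set Plane) ∩ interior (R i)).ncard = c i := by
  have hin : ∀ a : A, (a : Plane) ∈ interior (cell P φ (σ a)) := fun a =>
    IsCompatible.mem_interior_cell hf (hf.dot_pos_of_mem_interior (hA a.2)) (h a)
  have hout : ∀ (a : A) i, i ≠ σ a → (a : Plane) ∉ cell P φ i := fun a i hi ha =>
    absurd (ha.2 (σ a)) (not_le.2 (h a i hi))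
  refine ⟨cell P φ, IsCompatible.iUnion_cell, fun i j => hφ.disjoint_interior_cell,
    fun i => ⟨IsCompatible.convex_cell i, IsCompatible.isConvexPolygonalRegion_cell hf hφ i,
      IsCompatible.isExposed_edgeSet hf hφ i, fun a ha hfr => ?_, ?_⟩⟩
  · by_cases hi : i = σ ⟨a, ha⟩
    · subst hi
      exact hfr.2 (hin ⟨a, ha⟩)
    · exact hout ⟨a, ha⟩ i hi ((IsCompatible.isClosed_cell i).frontier_subset hfr)
  · have : (A : Set Plane) ∩ interior (cell P φ i) =
        ((Finset.univ.filter fun a => σ a = i).map (Function.Embedding.subtype _) : Finset Plane) := by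
      ext x
      simp only [Set.mem_inter_iff, Finset.mem_coe, Finset.mem_map, Finset.mem_filter,
        Finset.mem_univ, true_and, Function.Embedding.subtype_apply]
      constructor
      · rintro ⟨hx, hxi⟩
        refine ⟨⟨x, hx⟩, ?_, rfl⟩
        by_contra hne
        exact hout ⟨x, hx⟩ i (Ne.symm hne) (interior_subset hxi)
      · rintro ⟨a, rfl, rfl⟩
        exact ⟨a.2, hin a⟩
    rw [this, Set.ncard_coe_finset, Finset.card_map, hσ]

/-! ### Shortest paths, potentials and optimal assignments -/

section Potentials

variable {I : Type*}

/-- The total weight of the arcs between consecutive nodes of a list. -/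
def pathWeight (d : I → I → ℝ) : List I → ℝ
  | [] => 0
  | [_] => 0
  | i :: j :: l => d i j + pathWeight d (j :: l)

theorem pathWeight_split (d : I → I → ℝ) (l₁ : List I) (c : I) (l₂ : List I) :
    pathWeight d (l₁ ++ c :: l₂) = pathWeight d (l₁ ++ [c]) + pathWeight d (c :: l₂) := by
  induction l₁ with
  | nil => simp [pathWeight]
  | cons a l ih =>
    cases l with
    | nil => simp [pathWeight]
    | cons b l =>
      simp only [List.cons_append, pathWeight] at ih ⊢
      rw [ih]; ring

theorem pathWeight_eq_sum (d : I → I → ℝ) {π : I → I} {l : List I}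
    (h : l.IsChain fun x y => y = π x) :
    pathWeight d l = (l.dropLast.map fun x => d x (π x)).sum := by
  induction l with
  | nil => simp [pathWeight]
  | cons a l ih =>
    cases l with
    | nil => simp [pathWeight]
    | cons b l =>
      rw [List.isChain_cons_cons] at h
      rw [pathWeight, ih h.2, List.dropLast_cons_cons, List.map_cons, List.sum_cons, ← h.1]

theorem rel_of_isChain {R : I → I → Prop} {π : I → I} {l : List I} (hR : l.IsChain R)
    (h : l.IsChain fun x y => y = π x) : ∀ x ∈ l.dropLast, R x (π x) := by
  induction l with
  | nil => simp
  | cons a l ih =>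
    cases l with
    | nil => simp
    | cons b l =>
      rw [List.isChain_cons_cons] at h hR
      simp only [List.dropLast_cons_cons, List.mem_cons]
      rintro x (rfl | hx)
      · rw [← h.1]; exact hR.1
      · exact ih hR.2 h.2 x hx

variable [Fintype I] [DecidableEq I]

/-- Weighted digraphs in which all cycles have nonnegative weight have potentials. -/
theorem exists_potential {R : I → I → Prop} {d : I → I → ℝ}
    (h : ∀ π : Equiv.Perm I, π.IsCycle → (∀ x ∈ π.support, R x (π x)) →
      0 ≤ ∑ x ∈ π.support, d x (π x)) :
    ∃ u : I → ℝ, ∀ i j, i ≠ j → R i j → u i ≤ d i j + u j := by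
  classical
  -- A simple closed walk is the cyclic permutation `List.formPerm` of its nodes.
  have hcyc : ∀ i l, l ≠ [] → (i :: l).Nodup → (i :: l ++ [i]).IsChain R →
      0 ≤ pathWeight d (i :: l ++ [i]) := by
    intro i l hl hnd hR
    set π := (i :: l).formPerm
    have hlen : 2 ≤ (i :: l).length := by
      have := List.length_pos_of_ne_nil hl
      simp; omega
    have hchain : (i :: l ++ [i]).IsChain fun x y => y = π x := by
      rw [List.isChain_append]
      refine ⟨?_, by simp, ?_⟩
      · rw [List.isChain_iff_getElem]
        intro t ht
        exact (List.formPerm_apply_lt_getElem _ hnd t ht).symm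
      · intro x hx y hy
        rw [List.getLast?_eq_getLast_of_ne_nil (by simp)] at hx
        simp only [Option.mem_def, Option.some.injEq, List.head?_cons] at hx hy
        rw [← hx, ← hy]
        exact (List.formPerm_apply_getLast i l).symm
    have hsupp : π.support = (i :: l).toFinset :=
      List.support_formPerm_of_nodup _ hnd fun x hx => by rw [hx] at hlen; simp at hlen
    have hrel := rel_of_isChain hR hchain
    have hdl : (i :: l ++ [i]).dropLast = i :: l := List.dropLast_concat
    rw [pathWeight_eq_sum d hchain, hdl]
    rw [hdl] at hrel
    rw [← List.sum_toFinset _ hnd, ← hsupp]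
    refine h π (List.isCycle_formPerm hnd hlen) fun x hx => hrel x ?_
    rw [hsupp] at hx
    exact List.mem_toFinset.1 hx
  -- The potential of `i` is the least weight of a simple path starting at `i` and ending anywhere,
  -- so no connectivity is needed.
  let S : I → Finset {l : List I // l.Nodup} := fun i =>
    Finset.univ.filter fun l => l.1.head? = some i ∧ l.1.IsChain R
  have hS : ∀ i, (S i).Nonempty := fun i => ⟨⟨[i], by simp⟩, by simp [S]⟩
  choose p hp hmin using fun i => (S i).exists_min_image (fun l => pathWeight d l.1) (hS i)
  refine ⟨fun i => pathWeight d (p i).1, fun i j hij hR => ?_⟩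
  obtain ⟨hhead, hch⟩ := (Finset.mem_filter.1 (hp j)).2
  obtain ⟨l, hl⟩ : ∃ l, (p j).1 = j :: l := by
    cases hpj : (p j).1 with
    | nil => rw [hpj] at hhead; simp at hhead
    | cons a l => rw [hpj] at hhead; simp at hhead; exact ⟨l, by rw [hhead]⟩
  have hnd := (p j).2
  rw [hl] at hnd hch
  simp only [hl]
  -- If the best path from `j` meets `i`, the arc from `i` to `j` closes its first part to a cycle,
  -- and the rest competes at `i`. Otherwise prepend `i`.
  by_cases hi : i ∈ j :: l
  · obtain ⟨l₁, l₂, hs⟩ := List.append_of_mem hi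
    rw [hs] at hnd hch ⊢
    have hl₁ : l₁ ≠ [] := by
      rintro rfl
      simp at hs
      exact hij hs.1.symm
    obtain ⟨l₃, rfl⟩ : ∃ l₃, l₁ = j :: l₃ := by
      cases l₁ with
      | nil => exact absurd rfl hl₁
      | cons a l₃ => simp at hs; exact ⟨l₃, by rw [hs.1]⟩
    rw [List.isChain_split] at hch
    rw [pathWeight_split]
    have h1 : pathWeight d (p i).1 ≤ pathWeight d (i :: l₂) :=
      hmin i ⟨i :: l₂, hnd.of_append_right⟩ (by simp [S, hch.2])
    have hnd2 : (i :: (j :: l₃)).Nodup := by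
      rw [List.nodup_append] at hnd
      rw [List.nodup_cons]
      exact ⟨fun hm => hnd.2.2 i hm i (by simp) rfl, hnd.1⟩
    have h2 := hcyc i (j :: l₃) (by simp) hnd2 (by
      simp only [List.cons_append, List.isChain_cons_cons] at hch ⊢
      exact ⟨hR, hch.1⟩)
    simp only [List.cons_append, pathWeight] at h2 ⊢
    linarith
  · exact hmin i ⟨i :: j :: l, List.nodup_cons.2 ⟨hi, hnd⟩⟩ (by
      simp [S, List.isChain_cons_cons, hR, hch])

variable {A : Type*} [Fintype A]

/-- Potentials for an assignment `σ` of points to cells, along admissible reassignments. -/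
theorem exists_assignment_potential (σ : A → I) (T : A → I → Prop) (w : A → I → ℝ)
    (h : ∀ π : Equiv.Perm I, π.IsCycle → ∀ a : I → A,
      (∀ x ∈ π.support, σ (a x) = x ∧ T (a x) (π x)) →
      0 ≤ ∑ x ∈ π.support, (w (a x) (π x) - w (a x) x)) :
    ∃ u : I → ℝ, ∀ a j, j ≠ σ a → T a j → w a (σ a) + u (σ a) ≤ w a j + u j := by
  classical
  rcases isEmpty_or_nonempty A with hA | hA
  · exact ⟨0, fun a => isEmptyElim a⟩
  let S : I → I → Finset A := fun i j => Finset.univ.filter fun a => σ a = i ∧ T a j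
  have hex : ∀ i j, (S i j).Nonempty →
      ∃ a ∈ S i j, ∀ b ∈ S i j, w a j - w a i ≤ w b j - w b i := fun i j hne =>
    (S i j).exists_min_image (fun a => w a j - w a i) hne
  -- The arc from `i` to `j` is weighted by the cheapest move of a point from `i` to `j`.
  choose! q hq hmin using hex
  obtain ⟨u, hu⟩ := exists_potential (R := fun i j => (S i j).Nonempty)
    (d := fun i j => w (q i j) j - w (q i j) i) fun π hπ hR =>
      h π hπ (fun x => q x (π x)) fun x hx => (Finset.mem_filter.1 (hq x (π x) (hR x hx))).2
  refine ⟨u, fun a j hj hT => ?_⟩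
  have ha : a ∈ S (σ a) j := by simp [S, hT]
  have h1 := hu (σ a) j hj.symm ⟨a, ha⟩
  have h2 := hmin (σ a) j ⟨a, ha⟩ a ha
  linarith

/-- If the weights of all cycles are positive, then the potentials can be chosen strictly. -/
theorem exists_assignment_potential_lt (σ : A → I) (T : A → I → Prop) (w : A → I → ℝ)
    (h : ∀ π : Equiv.Perm I, π.IsCycle → ∀ a : I → A,
      (∀ x ∈ π.support, σ (a x) = x ∧ T (a x) (π x)) →
      0 < ∑ x ∈ π.support, (w (a x) (π x) - w (a x) x)) :
    ∃ u : I → ℝ, ∀ a j, j ≠ σ a → T a j → w a (σ a) + u (σ a) < w a j + u j := by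
  classical
  -- There are finitely many cycles, so lowering every arc by one small `ε` keeps them nonnegative;
  -- the slack makes the inequalities strict.
  have hev : ∀ᶠ ε : ℝ in nhdsWithin 0 (Set.Ioi 0), ∀ (π : Equiv.Perm I) (a : I → A),
      π.IsCycle → (∀ x ∈ π.support, σ (a x) = x ∧ T (a x) (π x)) →
      (π.support.card : ℝ) * ε < ∑ x ∈ π.support, (w (a x) (π x) - w (a x) x) := by
    simp only [Filter.eventually_all]
    intro π a hπ hx
    have : Filter.Tendsto (fun ε : ℝ => (π.support.card : ℝ) * ε) (nhdsWithin 0 (Set.Ioi 0))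
        (nhds 0) := by
      have : Continuous fun ε : ℝ => (π.support.card : ℝ) * ε := by fun_prop
      simpa using (this.tendsto 0).mono_left nhdsWithin_le_nhds
    exact this.eventually_lt_const (h π hπ a hx)
  obtain ⟨ε, hε, hpos⟩ := (hev.and self_mem_nhdsWithin).exists
  obtain ⟨u, hu⟩ := exists_assignment_potential σ T
    (fun a j => w a j - if j = σ a then 0 else ε) fun π hπ a hx => by
      have h1 := hε π a hπ hx
      have h2 : ∑ x ∈ π.support, ((w (a x) (π x) - if π x = σ (a x) then 0 else ε) -
          (w (a x) x - if x = σ (a x) then 0 else ε)) =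
          ∑ x ∈ π.support, ((w (a x) (π x) - w (a x) x) - ε) := by
        refine Finset.sum_congr rfl fun x hx' => ?_
        rw [(hx x hx').1, if_neg (Equiv.Perm.mem_support.1 hx'), if_pos rfl]
        ring
      rw [h2, Finset.sum_sub_distrib, Finset.sum_const, nsmul_eq_mul]
      linarith
  refine ⟨u, fun a j hj hT => ?_⟩
  have h3 := hu a j hj hT
  rw [if_pos rfl, if_neg hj] at h3
  have : (0 : ℝ) < ε := hpos
  linarith

/-- An assignment that is minimal among the admissible ones obtained by permuting the points has no
negative cycles. -/
theorem sum_cycle_nonneg_of_minimal {σ : A → I} {T : A → I → Prop} {w : A → I → ℝ}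
    (hσ : ∀ a, T a (σ a))
    (hmin : ∀ τ : Equiv.Perm A, (∀ a, T a (σ (τ a))) → ∑ a, w a (σ a) ≤ ∑ a, w a (σ (τ a)))
    (π : Equiv.Perm I) (a : I → A) (ha : ∀ x ∈ π.support, σ (a x) = x ∧ T (a x) (π x)) :
    0 ≤ ∑ x ∈ π.support, (w (a x) (π x) - w (a x) x) := by
  classical
  let e : {x // x ∈ π.support} ↪ A := ⟨fun x => a x, fun x y hxy => Subtype.ext <| by
    have := congrArg σ hxy
    simp only [(ha x x.2).1, (ha y y.2).1] at this
    exact this⟩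
  let π' : Equiv.Perm {x // x ∈ π.support} := π.subtypePerm fun x => Equiv.Perm.apply_mem_support
  let τ := π'.viaFintypeEmbedding e
  have hτ1 : ∀ x (hx : x ∈ π.support), σ (τ (a x)) = π x := fun x hx => by
    have h1 : τ (e ⟨x, hx⟩) = e (π' ⟨x, hx⟩) := Equiv.Perm.viaFintypeEmbedding_apply_image _ _ _
    have h2 : τ (a x) = a (π x) := h1
    rw [h2]
    exact (ha (π x) (Equiv.Perm.apply_mem_support.2 hx)).1
  have hτ2 : ∀ b, b ∉ π.support.image a → τ b = b := fun b hb =>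
    Equiv.Perm.viaFintypeEmbedding_apply_notMem_range _ _ fun ⟨x, hx⟩ =>
      hb (Finset.mem_image.2 ⟨x, x.2, hx⟩)
  have hle := hmin τ fun b => by
    by_cases hb : b ∈ π.support.image a
    · obtain ⟨x, hx, rfl⟩ := Finset.mem_image.1 hb
      rw [hτ1 x hx]
      exact (ha x hx).2
    · rw [hτ2 b hb]
      exact hσ b
  have hsum : ∑ b, (w b (σ (τ b)) - w b (σ b)) =
      ∑ x ∈ π.support, (w (a x) (π x) - w (a x) x) := by
    rw [← Finset.sum_subset (Finset.subset_univ (π.support.image a)) fun b _ hb => by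
      rw [hτ2 b hb, sub_self]]
    rw [Finset.sum_image fun x hx y hy hxy => by
      rw [← (ha x hx).1, ← (ha y hy).1, hxy]]
    refine Finset.sum_congr rfl fun x hx => ?_
    rw [hτ1 x hx, (ha x hx).1]
  rw [← hsum, Finset.sum_sub_distrib]
  linarith

end Potentials

/-! ### Noncrossing cyclic permutations -/

section NoncrossingCycle

variable {m : ℕ}

/-- `k` and `l` are on different sides of the chord joining `i` and `j`. -/
def Crosses {n : ℕ} (i j k l : Fin n) : Prop :=
  (min i j < k ∧ k < max i j) ∧ (l < min i j ∨ max i j < l)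

theorem Equiv.Perm.IsCycle.forall_of_closed {α : Type*} [Fintype α] [DecidableEq α]
    {π : Equiv.Perm α} (hπ : π.IsCycle) (hs : π.support = Finset.univ) {p : α → Prop}
    (hp : ∀ x, p x → p (π x)) {x : α} (hx : p x) (y : α) : p y := by
  have hne : ∀ z, π z ≠ z := fun z => Equiv.Perm.mem_support.1 (hs ▸ Finset.mem_univ z)
  obtain ⟨t, rfl⟩ := hπ.exists_pow_eq (hne x) (hne y)
  induction t with
  | zero => exact hx
  | succ t ih =>
    rw [pow_succ', Equiv.Perm.mul_apply]
    exact hp _ ih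

/-- The chords of a noncrossing cyclic permutation join neighbours. -/
theorem apply_eq_add_one_or_of_noncrossing {π : Equiv.Perm (Fin (m + 3))} (hπ : π.IsCycle)
    (hs : π.support = Finset.univ)
    (hnc : ∀ x y, x ≠ y → ¬ Crosses x (π x) y (π y) ∧ ¬ Crosses x (π x) (π y) y)
    (x : Fin (m + 3)) : π x = x + 1 ∨ π x = x - 1 := by
  have hne : π x ≠ x := Equiv.Perm.mem_support.1 (hs ▸ Finset.mem_univ x)
  set i := min x (π x)
  set j := max x (π x)
  have hxij : x = i ∧ π x = j ∨ x = j ∧ π x = i := by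
    rcases le_total x (π x) with h | h
    · left; simp [i, j, h]
    · right; simp [i, j, h]
  have hij : i < j := by
    rcases hxij with ⟨h1, h2⟩ | ⟨h1, h2⟩
    · exact lt_of_le_of_ne min_le_max (by rw [← h1, ← h2]; exact hne.symm)
    · exact lt_of_le_of_ne min_le_max (by rw [← h1, ← h2]; exact hne)
  set K : Fin (m + 3) → Prop := fun k => i < k ∧ k < j
  set N : Fin (m + 3) → Prop := fun k => k < i ∨ j < k
  have htri : ∀ y, y ≠ x → y ≠ π x → K y ∨ N y := by
    intro y h1 h2
    have h3 : y ≠ i ∧ y ≠ j := by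
      rcases hxij with ⟨e1, e2⟩ | ⟨e1, e2⟩
      · exact ⟨e1 ▸ h1, e2 ▸ h2⟩
      · exact ⟨e2 ▸ h2, e1 ▸ h1⟩
    rcases lt_or_gt_of_ne h3.1 with h | h
    · exact Or.inr (Or.inl h)
    rcases lt_or_gt_of_ne h3.2 with h' | h'
    · exact Or.inl ⟨h, h'⟩
    · exact Or.inr (Or.inr h')
  have hdisj : ∀ y, K y → N y → False := by
    rintro y ⟨h1, h2⟩ (h | h)
    · exact (h.trans h1).false
    · exact (h.trans h2).false
  have hxK : ¬ K x := by
    rintro ⟨h1, h2⟩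
    rcases hxij with ⟨e1, e2⟩ | ⟨e1, e2⟩
    · exact h1.ne e1.symm
    · exact h2.ne e1
  have hxN : ¬ N x := by
    rintro (h | h)
    · exact absurd h (not_lt.2 (min_le_left _ _))
    · exact absurd h (not_lt.2 (le_max_left _ _))
  have hstep : ∀ y, y ≠ x → π y = x ∨ K (π y) ∨ N (π y) := fun y hy => by
    by_cases h : π y = x
    · exact Or.inl h
    · exact Or.inr (htri _ h fun h2 => hy (π.injective h2))
  have hK : ∀ y, K y → π y = x ∨ K (π y) := fun y hy => by
    have hyx : y ≠ x := fun h => hxK (h ▸ hy)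
    rcases hstep y hyx with h | h | h
    · exact Or.inl h
    · exact Or.inr h
    · exact absurd ⟨hy, h⟩ (hnc x y hyx.symm).1
  have hN : ∀ y, N y → π y = x ∨ N (π y) := fun y hy => by
    have hyx : y ≠ x := fun h => hxN (h ▸ hy)
    rcases hstep y hyx with h | h | h
    · exact Or.inl h
    · exact absurd ⟨h, hy⟩ (hnc x y hyx.symm).2
    · exact Or.inr h
  -- From either side of the chord `π` can leave only to `x`. The side without `π⁻¹ x` is closed
  -- under `π`, so if nonempty it would contain `x`.
  have hor : (∀ k, ¬ K k) ∨ ∀ k, ¬ N k := by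
    by_contra! hcon
    obtain ⟨⟨k, hk⟩, ⟨l, hl⟩⟩ := hcon
    by_cases hz : K (π.symm x)
    · refine hxN (hπ.forall_of_closed hs (p := N) (fun y hy => ?_) hl x)
      rcases hN y hy with h | h
      · rw [← h, Equiv.symm_apply_apply] at hz
        exact (hdisj y hz hy).elim
      · exact h
    · refine hxK (hπ.forall_of_closed hs (p := K) (fun y hy => ?_) hk x)
      rcases hK y hy with h | h
      · rw [← h, Equiv.symm_apply_apply] at hz
        exact (hz hy).elim
      · exact h
  have hadj : j = i + 1 ∨ i = j + 1 := by
    rcases hor with h | h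
    · left
      by_contra hne
      have hv := fin_val_add_one hij
      refine h (i + 1) ⟨by rw [Fin.lt_def]; omega, ?_⟩
      have : j.val ≠ (i + 1).val := fun h => hne (Fin.ext h)
      rw [Fin.lt_def] at hij ⊢
      omega
    · right
      have h0 : ¬ (0 : Fin (m + 3)) < i := fun h' => h 0 (Or.inl h')
      have h1 : ¬ j < Fin.last (m + 2) := fun h' => h _ (Or.inr h')
      have e0 : i = 0 := by simpa using h0
      have e1 : j = Fin.last (m + 2) := by simpa using h1
      rw [e0, e1, Fin.last_add_one]
  rcases hxij with ⟨e1, e2⟩ | ⟨e1, e2⟩ <;> rw [e2, e1] <;> rcases hadj with h | h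
  · exact Or.inl h
  · right; rw [h, add_sub_cancel_right]
  · right; rw [h, add_sub_cancel_right]
  · exact Or.inl h

theorem forall_add_one_or_forall_sub_one {π : Equiv.Perm (Fin (m + 3))} (hπ : π.IsCycle)
    (hs : π.support = Finset.univ) (h : ∀ x, π x = x + 1 ∨ π x = x - 1) :
    (∀ x, π x = x + 1) ∨ ∀ x, π x = x - 1 := by
  by_cases hex : ∃ x, π x = x + 1
  · obtain ⟨x, hx⟩ := hex
    left
    refine fin_forall_of_add_one (fun y hy => (h (y + 1)).resolve_right fun h2 => ?_) hx
    rw [add_sub_cancel_right] at h2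
    have := hπ.forall_of_closed hs (p := fun z => z = y ∨ z = y + 1)
      (by rintro z (rfl | rfl) <;> simp [hy, h2]) (Or.inl rfl) (y + 1 + 1)
    rcases this with h3 | h3
    · exact fin_add_two_ne y h3
    · exact fin_add_one_ne _ h3
  · push Not at hex
    exact Or.inr fun x => (h x).resolve_left (hex x)

end NoncrossingCycle

/-! ### No cycle of ties balances for all heights -/

namespace IsEdgeSystem

variable {m : ℕ} {P : Polygon Plane (m + 3)} {f : Fin (m + 3) → Fin 3 → ℝ}

/-- A positive combination of `f i`, `f j` equals one of `f k`, `f l`. Evaluated at `v` and `w`, it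
bounds the two sums of coefficients by each other, so equality holds throughout and the points agree
on three independent functionals. -/
theorem eq_of_lt_of_lt_of_lt (hf : IsEdgeSystem P.vertices f) {i k j l : Fin (m + 3)} (hik : i < k)
    (hkj : k < j) (hjl : j < l) {v w : Fin 3 → ℝ} (hvi : f i ⬝ᵥ v = 1) (hvj : f j ⬝ᵥ v = 1)
    (hv : ∀ t, 1 ≤ f t ⬝ᵥ v) (hwk : f k ⬝ᵥ w = 1) (hwl : f l ⬝ᵥ w = 1)
    (hw : ∀ t, 1 ≤ f t ⬝ᵥ w) : v = w := by
  obtain ⟨κ, hκ⟩ := hf.exists_orientation_of_lt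
  have d1 := hκ k j l hkj hjl
  have d2 := hκ i j l (hik.trans hkj) hjl
  have d3 := hκ i k l hik (hkj.trans hjl)
  have d4 := hκ i k j hik hkj
  have ev := det3_four_term (f i) (f k) (f j) (f l) v
  have ew := det3_four_term (f i) (f k) (f j) (f l) w
  rw [hvi, hvj] at ev
  rw [hwk, hwl] at ew
  have mv1 := mul_nonneg d2.le (sub_nonneg.2 (hv k))
  have mv2 := mul_nonneg d4.le (sub_nonneg.2 (hv l))
  have mw1 := mul_nonneg d1.le (sub_nonneg.2 (hw i))
  have mw2 := mul_nonneg d3.le (sub_nonneg.2 (hw j))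
  have ev' := congrArg (κ * ·) ev
  have ew' := congrArg (κ * ·) ew
  have zk : κ * det3 (f i) (f j) (f l) * (f k ⬝ᵥ v - 1) = 0 := by linarith
  have zi : κ * det3 (f k) (f j) (f l) * (f i ⬝ᵥ w - 1) = 0 := by linarith
  have zj : κ * det3 (f i) (f k) (f l) * (f j ⬝ᵥ w - 1) = 0 := by linarith
  have hvk := (mul_eq_zero.1 zk).resolve_left d2.ne'
  have hwi := (mul_eq_zero.1 zi).resolve_left d1.ne'
  have hwj := (mul_eq_zero.1 zj).resolve_left d3.ne'
  rw [← sub_eq_zero]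
  apply eq_zero_of_dot_eq_zero (right_ne_zero_of_mul d4.ne') <;> rw [dotProduct_sub] <;> linarith

/-- Two different points cannot tie along crossing pairs of edges. -/
theorem eq_of_crosses (hf : IsEdgeSystem P.vertices f) {i k j l : Fin (m + 3)}
    (h : Crosses i j k l) {v w : Fin 3 → ℝ} (hvi : f i ⬝ᵥ v = 1) (hvj : f j ⬝ᵥ v = 1)
    (hv : ∀ t, 1 ≤ f t ⬝ᵥ v) (hwk : f k ⬝ᵥ w = 1) (hwl : f l ⬝ᵥ w = 1)
    (hw : ∀ t, 1 ≤ f t ⬝ᵥ w) : v = w := by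
  wlog hij : i ≤ j generalizing i j
  · refine this (i := j) (j := i) ?_ hvj hvi (le_of_not_ge hij)
    rwa [Crosses, min_comm, max_comm]
  rw [Crosses, min_eq_left hij, max_eq_right hij] at h
  obtain ⟨⟨h1, h2⟩, h3 | h3⟩ := h
  · exact (hf.eq_of_lt_of_lt_of_lt h3 h1 h2 hwl hwk hw hvi hvj hv).symm
  · exact hf.eq_of_lt_of_lt_of_lt h1 h2 h3 hvi hvj hv hwk hwl hw

theorem vertices_injective (hf : IsEdgeSystem P.vertices f) : Function.Injective P.vertices := by
  intro i j h
  by_contra hne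
  by_cases h1 : i = j + 1
  · subst h1
    have := hf.pos_two (j)
    have h2 := hf.pos_succ j
    rw [← h, hf.1] at h2
    exact h2.false
  · have h2 := hf.2.2 j i hne h1
    rw [h, hf.1] at h2
    exact h2.false

theorem mem_line_of_smul_eq {x y z : Plane} {α β γ : ℝ} (hγ : γ ≠ 0) {q : Fin 3 → ℝ}
    (hq : q = γ • hom z) (h : q = α • hom x + β • hom y) : z ∈ line[ℝ, x, y] := by
  rw [hq] at h
  have h0 := congrFun h 0
  have h1 := congrFun h 1
  have h2 := congrFun h 2
  simp [hom] at h0 h1 h2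
  refine mem_affineSpan_pair_iff_exists_lineMap_eq.2 ⟨β / γ, ?_⟩
  ext i
  fin_cases i
  · simp [AffineMap.lineMap_apply]; field_simp; linear_combination x 0 * h2 - h0
  · simp [AffineMap.lineMap_apply]; field_simp; linear_combination x 1 * h2 - h1

/-- In general⁺ position, the lines joining the vertices to points inside are not concurrent. -/
theorem not_concurrent (hf : IsEdgeSystem P.vertices f) {S : Set Plane}
    (hS : S ⊆ interior P.region) (hgen : InGeneralPlusPosition (Set.range P.vertices ∪ S))
    {b : Fin (m + 3) → Plane} (hb : ∀ x, b x ∈ S) (hinj : Function.Injective b)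
    {q : Fin 3 → ℝ} {μ α : Fin (m + 3) → ℝ}
    (h : ∀ x, μ x • hom (b x) = q + α x • hom (P.vertices x)) (hq : ∀ x, f x ⬝ᵥ q = 1) : False := by
  -- The common point is not at infinity: otherwise `exists_vertex`, for the functional in the
  -- direction of `q`, makes its squared length nonpositive.
  have hq2 : q 2 ≠ 0 := by
    intro h0
    obtain ⟨k, c, d, hc, hd, hk⟩ := hf.exists_vertex ![q 0, q 1, 0]
    have h1 := hk q
    rw [hq, hq, h0] at h1
    simp [dotProduct, Fin.sum_univ_three] at h1
    have e0 : q 0 = 0 := by nlinarith [sq_nonneg (q 0), sq_nonneg (q 1)]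
    have e1 : q 1 = 0 := by nlinarith [sq_nonneg (q 0), sq_nonneg (q 1)]
    have := hq 0
    simp [dotProduct, Fin.sum_univ_three, e0, e1, h0] at this
  have hbP : ∀ x y, b x ≠ P.vertices y := fun x y hxy => by
    have := hf.dot_pos_of_mem_interior (hS (hb x)) y
    rw [hxy, hf.1] at this
    exact this.false
  set X : Plane := !₂[q 0 / q 2, q 1 / q 2]
  have hX : q = q 2 • hom X := by
    ext i
    fin_cases i <;> simp [hom, X] <;> field_simp
  have hline : ∀ x, X ∈ line[ℝ, P.vertices x, b x] := fun x =>
    mem_line_of_smul_eq hq2 hX (α := -α x) (β := μ x) (by rw [h x]; module)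
  have h01 : (0 : Fin (m + 3)) ≠ 1 := by simp
  have h12 : (1 : Fin (m + 3)) ≠ 1 + 1 := by simp
  have h02 : (0 : Fin (m + 3)) ≠ 1 + 1 := by
    simpa using (fin_add_two_ne (0 : Fin (m + 3))).symm
  refine hgen.2 ![P.vertices 0, b 0, P.vertices 1, b 1, P.vertices (1 + 1), b (1 + 1)] ?_ ?_
    ⟨X, hline 0, hline 1, hline (1 + 1)⟩
  · have hbi : ∀ x y, b x = b y ↔ x = y := fun x y => hinj.eq_iff
    have hPi : ∀ x y, P.vertices x = P.vertices y ↔ x = y := fun x y =>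
      hf.vertices_injective.eq_iff
    have hPb : ∀ x y, P.vertices y ≠ b x := fun x y => (hbP x y).symm
    intro i j hij
    fin_cases i <;> fin_cases j <;>
      simp [hbP, hPb, hbi, hPi, h01, h12, h02, h01.symm, h12.symm, h02.symm] at hij ⊢
  · intro i
    fin_cases i
    · exact Or.inl ⟨0, rfl⟩
    · exact Or.inr (hb _)
    · exact Or.inl ⟨1, rfl⟩
    · exact Or.inr (hb _)
    · exact Or.inl ⟨1 + 1, rfl⟩
    · exact Or.inr (hb _)

/-- For a suitable choice of heights, the perturbation does not balance out along a given cycle. -/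
theorem exists_interp_sum_ne_zero (hf : IsEdgeSystem P.vertices f) {A : Finset Plane}
    (hA : (A : Set Plane) ⊆ interior P.region)
    (hgen : InGeneralPlusPosition (Set.range P.vertices ∪ (A : Set Plane)))
    {F : A → ℝ} (hF : ∀ a, 0 < F a) (hFle : ∀ (a : A) j, F a ≤ f j ⬝ᵥ hom a)
    {π : Equiv.Perm (Fin (m + 3))} (hπ : π.IsCycle) {a : Fin (m + 3) → A}
    (hinj : ∀ x ∈ π.support, ∀ y ∈ π.support, a x = a y → x = y)
    (hx : ∀ x ∈ π.support, f x ⬝ᵥ hom (a x) = F (a x))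
    (hπx : ∀ x ∈ π.support, f (π x) ⬝ᵥ hom (a x) = F (a x)) :
    ∃ h : Fin (m + 3) → ℝ, ∑ x ∈ π.support, (interp P f h (π x) ⬝ᵥ hom (a x) / F (a x) -
      interp P f h x ⬝ᵥ hom (a x) / F (a x)) ≠ 0 := by
  by_contra! hcon
  -- Normalised so that tied functionals take the value 1 and all others at least 1.
  set w : Fin (m + 3) → Fin 3 → ℝ := fun x => (F (a x))⁻¹ • hom (a x)
  have hwinj : ∀ x ∈ π.support, ∀ y ∈ π.support, w x = w y → x = y := by
    intro x hx y hy hxy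
    refine hinj x hx y hy (Subtype.ext (hom_injective ?_))
    have h2 := congrFun hxy 2
    simp [w, hom] at h2
    have h3 : (F (a x))⁻¹ • hom (a x) = (F (a x))⁻¹ • hom (a y) := by
      change w x = _
      rw [hxy]; simp only [w, h2]
    exact smul_right_injective _ (inv_ne_zero (hF (a x)).ne') h3
  have hw1 : ∀ x ∈ π.support, f x ⬝ᵥ w x = 1 := fun x hx' => by
    rw [dotProduct_smul, hx x hx', smul_eq_mul, inv_mul_cancel₀ (hF _).ne']
  have hw2 : ∀ x ∈ π.support, f (π x) ⬝ᵥ w x = 1 := fun x hx' => by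
    rw [dotProduct_smul, hπx x hx', smul_eq_mul, inv_mul_cancel₀ (hF _).ne']
  have hw3 : ∀ x j, 1 ≤ f j ⬝ᵥ w x := fun x j => by
    rw [dotProduct_smul, smul_eq_mul, ← inv_mul_cancel₀ (hF (a x)).ne']
    exact mul_le_mul_of_nonneg_left (hFle _ j) (inv_nonneg.2 (hF _).le)
  set V : Fin (m + 3) → Fin 3 → ℝ := fun x => w (π⁻¹ x) - w x
  have hV0 : ∀ x, x ∉ π.support → V x = 0 := fun x hx' => by
    rw [← Equiv.Perm.support_inv, Equiv.Perm.notMem_support] at hx'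
    simp only [V, hx', sub_self]
  have hsymm : ∀ x, x ∈ π.support → π⁻¹ x ∈ π.support := fun x hx' => by
    rw [← Equiv.Perm.support_inv] at hx' ⊢
    exact Equiv.Perm.apply_mem_support.2 hx'
  have hVf : ∀ x, f x ⬝ᵥ V x = 0 := fun x => by
    by_cases hx' : x ∈ π.support
    · have := hw2 _ (hsymm x hx')
      rw [show π (π⁻¹ x) = x by simp] at this
      rw [dotProduct_sub, this, hw1 x hx', sub_self]
    · rw [hV0 x hx', dotProduct_zero]
  have hsum : ∀ h, ∑ x, interp P f h x ⬝ᵥ V x = 0 := fun h => by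
    rw [← hcon h]
    have e1 : ∀ x j, interp P f h j ⬝ᵥ hom (a x) / F (a x) = interp P f h j ⬝ᵥ w x := fun x j => by
      rw [dotProduct_smul, smul_eq_mul, div_eq_inv_mul]
    simp only [e1]
    rw [Finset.sum_subset (Finset.subset_univ π.support) fun x _ hx' => by
      rw [Equiv.Perm.notMem_support.1 hx', sub_self]]
    simp only [V, dotProduct_sub, Finset.sum_sub_distrib]
    congr 1
    rw [← Equiv.sum_comp π]
    simp
  -- The coefficient of the height at vertex `k + 1`, which only edges `k` and `k + 1` see.
  have hcoef : ∀ k, leftCoord P f (k + 1) ⬝ᵥ V (k + 1) + rightCoord P f k ⬝ᵥ V k = 0 := by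
    intro k
    have h1 := hsum (Pi.single (k + 1) 1)
    simp only [interp, add_dotProduct, smul_dotProduct, smul_eq_mul, Finset.sum_add_distrib,
      Pi.single_apply, ite_mul, one_mul, zero_mul, add_left_inj, Finset.sum_ite_eq',
      Finset.mem_univ, if_true] at h1
    exact h1
  have hdec := fun x => hf.eq_add_of_dot_eq_zero (hVf x)
  -- If `k` is in the support but `k + 1` is not, `V k` is a multiple of vertex `k`, which is then
  -- collinear with two points of `A`.
  have hfull : ∀ x, x ∈ π.support := by
    obtain ⟨x₀, hx₀⟩ := hπ.nonempty_support
    refine fin_forall_of_add_one (p := fun x => x ∈ π.support) (fun k hk => ?_) hx₀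
    by_contra hk1
    have h1 := hcoef k
    rw [hV0 _ hk1, dotProduct_zero, zero_add] at h1
    have h2 := hdec k
    rw [h1, zero_smul, add_zero] at h2
    set α := leftCoord P f k ⬝ᵥ V k
    have hk' := hsymm k hk
    have hne : π⁻¹ k ≠ k := by
      rw [← Equiv.Perm.mem_support, Equiv.Perm.support_inv]; exact hk
    have hα : α ≠ 0 := fun h0 => by
      rw [h0, zero_smul] at h2
      exact hne (hwinj _ hk' _ hk (sub_eq_zero.1 h2))
    have hmem : P.vertices k ∈ line[ℝ, (a k : Plane), (a (π⁻¹ k) : Plane)] :=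
      mem_line_of_smul_eq hα h2 (α := -(F (a k))⁻¹) (β := (F (a (π⁻¹ k)))⁻¹)
        (by simp only [V, w]; module)
    have hPa : ∀ b : A, P.vertices k ≠ b := fun b hb => by
      have := hf.dot_pos_of_mem_interior (hA b.2) k
      rw [← hb, hf.1] at this
      exact this.false
    exact hgen.1 _ (Or.inl ⟨k, rfl⟩) _ (Or.inr (a k).2) _ (Or.inr (a (π⁻¹ k)).2) (hPa _) (hPa _)
      (fun h => hne (hinj _ hk' _ hk (Subtype.ext h.symm)))
      (collinear_insert_of_mem_affineSpan_pair hmem)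
  have huniv : π.support = Finset.univ := Finset.eq_univ_iff_forall.2 hfull
  have hcross : ∀ x y, x ≠ y → ¬ Crosses x (π x) y (π y) ∧ ¬ Crosses x (π x) (π y) y := by
    intro x y hxy
    constructor
    · exact fun hc => hxy (hwinj x (hfull x) y (hfull y) (hf.eq_of_crosses hc (hw1 x (hfull x))
        (hw2 x (hfull x)) (hw3 x) (hw1 y (hfull y)) (hw2 y (hfull y)) (hw3 y)))
    · exact fun hc => hxy (hwinj x (hfull x) y (hfull y) (hf.eq_of_crosses hc (hw1 x (hfull x))
        (hw2 x (hfull x)) (hw3 x) (hw2 y (hfull y)) (hw1 y (hfull y)) (hw3 y)))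
  set α : Fin (m + 3) → ℝ := fun x => leftCoord P f x ⬝ᵥ V x
  have hVα : ∀ x, V x = α x • hom (P.vertices x) - α (x + 1) • hom (P.vertices (x + 1)) := by
    intro x
    have h1 : rightCoord P f x ⬝ᵥ V x = -α (x + 1) := by
      have := hcoef x
      simp only [α]
      linarith
    have h2 := hdec x
    rw [h1] at h2
    rw [h2]
    simp only [α]
    module
  have hainj : Function.Injective fun x => (a x : Plane) := fun x y hxy =>
    hinj x (hfull x) y (hfull y) (Subtype.ext hxy)
  rcases forall_add_one_or_forall_sub_one hπ huniv
    (apply_eq_add_one_or_of_noncrossing hπ huniv hcross) with hp | hp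
  · have hinv : ∀ x, π⁻¹ x = x - 1 := fun x => by
      rw [Equiv.Perm.inv_eq_iff_eq, hp, sub_add_cancel]
    -- The relations telescope: this vector is independent of `x` and lies on every line from vertex
    -- `x` to `a (x - 1)`.
    have hconst := fin_forall_of_add_one (i := 0)
      (p := fun x => w (x - 1) - α x • hom (P.vertices x) = w (0 - 1) - α 0 • hom (P.vertices 0))
      (fun x ih => by
        have h1 := hVα x
        simp only [V, hinv] at h1
        rw [← ih, add_sub_cancel_right]
        linear_combination (exp := 1) -h1) rfl
    refine hf.not_concurrent hA hgen (b := fun x => a (x - 1)) (fun x => (a _).2)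
      (hainj.comp (sub_left_injective)) (q := w (0 - 1) - α 0 • hom (P.vertices 0))
      (μ := fun x => (F (a (x - 1)))⁻¹) (α := α) (fun x => ?_) fun x => ?_
    · rw [← hconst x, sub_add_cancel]
    · rw [← hconst x, dotProduct_sub, dotProduct_smul (α x), hf.1, smul_zero, sub_zero]
      have := hw2 (x - 1) (hfull _)
      rwa [hp, sub_add_cancel] at this
  · have hinv : ∀ x, π⁻¹ x = x + 1 := fun x => by
      rw [Equiv.Perm.inv_eq_iff_eq, hp, add_sub_cancel_right]
    have hconst := fin_forall_of_add_one (i := 0)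
      (p := fun x => w x + α x • hom (P.vertices x) = w 0 + α 0 • hom (P.vertices 0))
      (fun x ih => by
        have h1 := hVα x
        simp only [V, hinv] at h1
        rw [← ih]
        linear_combination (exp := 1) h1) rfl
    refine hf.not_concurrent hA hgen (b := fun x => a x) (fun x => (a _).2)
      hainj (q := w 0 + α 0 • hom (P.vertices 0))
      (μ := fun x => (F (a x))⁻¹) (α := fun x => -α x) (fun x => ?_) fun x => ?_
    · rw [← hconst x, neg_smul, add_neg_cancel_right]
    · rw [← hconst x, dotProduct_add, dotProduct_smul (α x), hf.1, smul_zero, add_zero]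
      exact hw1 x (hfull x)

end IsEdgeSystem

/-! ### Scaling, generic heights and perturbation -/

namespace IsEdgeSystem

variable {m : ℕ} {P : Polygon Plane (m + 3)} {f : Fin (m + 3) → Fin 3 → ℝ} {A : Finset Plane}

/-- The edge functionals can be scaled so that a minimizing functional at each point yields an
assignment with prescribed numbers of points. -/
theorem exists_scaling (hf : IsEdgeSystem P.vertices f)
    (hA : (A : Set Plane) ⊆ interior P.region) {c : Fin (m + 3) → ℕ} (hc : ∑ i, c i = A.card) :
    ∃ s : Fin (m + 3) → ℝ, (∀ i, 0 < s i) ∧ ∃ σ : A → Fin (m + 3),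
      (∀ i, (Finset.univ.filter fun a => σ a = i).card = c i) ∧
      ∀ a j, (s (σ a) • f (σ a)) ⬝ᵥ hom a ≤ (s j • f j) ⬝ᵥ hom a := by
  classical
  have hpos : ∀ (a : A) j, 0 < f j ⬝ᵥ hom a := fun a j =>
    hf.dot_pos_of_mem_interior (hA a.2) j
  have e : A ≃ Σ i, Fin (c i) := Fintype.equivOfCardEq (by simp [hc])
  set σ₀ : A → Fin (m + 3) := fun a => (e a).1
  have hσ₀ : ∀ i, (Finset.univ.filter fun a => σ₀ a = i).card = c i := fun i => by
    rw [← Fintype.card_subtype, Fintype.card_congr ((e.subtypeEquiv fun a => Iff.rfl :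
      {a // σ₀ a = i} ≃ {x : Σ i, Fin (c i) // x.1 = i}).trans (Equiv.sigmaSubtype i)),
      Fintype.card_fin]
  -- Logarithms turn additive potentials into positive scaling factors.
  set w : A → Fin (m + 3) → ℝ := fun a j => Real.log (f j ⬝ᵥ hom a)
  obtain ⟨τ₀, -, hτ₀⟩ := Finset.univ.exists_min_image
    (fun τ : Equiv.Perm A => ∑ a, w a (σ₀ (τ a))) ⟨1, Finset.mem_univ _⟩
  obtain ⟨u, hu⟩ := exists_assignment_potential (fun a => σ₀ (τ₀ a)) (fun _ _ => True) w
    fun π _ a ha => sum_cycle_nonneg_of_minimal (T := fun _ _ => True) (fun _ => trivial)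
      (fun τ _ => hτ₀ (τ₀ * τ) (Finset.mem_univ _)) π a ha
  refine ⟨fun i => Real.exp (u i), fun i => Real.exp_pos _, fun a => σ₀ (τ₀ a), fun i => ?_,
    fun a j => ?_⟩
  · rw [← hσ₀ i]
    exact Finset.card_equiv τ₀ fun a => by simp
  · by_cases hj : j = σ₀ (τ₀ a)
    · rw [hj]
    · have h := Real.exp_le_exp.2 (hu a j hj trivial)
      rw [Real.exp_add, Real.exp_add, Real.exp_log (hpos _ _), Real.exp_log (hpos _ _)] at h
      simp only [smul_dotProduct, smul_eq_mul]
      linarith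

theorem interp_dot (h : Fin (m + 3) → ℝ) (i : Fin (m + 3)) (v : Fin 3 → ℝ) :
    interp P f h i ⬝ᵥ v = h i * (leftCoord P f i ⬝ᵥ v) + h (i + 1) * (rightCoord P f i ⬝ᵥ v) := by
  simp [interp]

theorem interp_dot_left (hf : IsEdgeSystem P.vertices f) (h : Fin (m + 3) → ℝ) (i : Fin (m + 3)) :
    interp P f h i ⬝ᵥ hom (P.vertices i) = h i := by
  have h1 := hf.pos_succ i
  have h3 := hf.2.1 (i - 1)
  rw [sub_add_cancel] at h3
  rw [interp_dot, leftCoord, rightCoord, smul_dotProduct, smul_dotProduct, h3, smul_eq_mul,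
    inv_mul_cancel₀ h1.ne']
  simp

theorem interp_dot_right (hf : IsEdgeSystem P.vertices f) (h : Fin (m + 3) → ℝ)
    (i : Fin (m + 3)) : interp P f h i ⬝ᵥ hom (P.vertices (i + 1)) = h (i + 1) := by
  have h1 := hf.pos_pred i
  rw [interp_dot, leftCoord, rightCoord, smul_dotProduct, smul_dotProduct, hf.1, smul_eq_mul,
    smul_eq_mul, inv_mul_cancel₀ h1.ne']
  simp

/-- Heights for which the perturbation does not balance out along any cycle of ties. -/
theorem exists_generic_heights (hf : IsEdgeSystem P.vertices f)
    (hA : (A : Set Plane) ⊆ interior P.region)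
    (hgen : InGeneralPlusPosition (Set.range P.vertices ∪ (A : Set Plane)))
    {F : A → ℝ} (hF : ∀ a, 0 < F a) (hFle : ∀ (a : A) j, F a ≤ f j ⬝ᵥ hom a) :
    ∃ h : Fin (m + 3) → ℝ, ∀ (π : Equiv.Perm (Fin (m + 3))) (a : Fin (m + 3) → A), π.IsCycle →
      (∀ x ∈ π.support, ∀ y ∈ π.support, a x = a y → x = y) →
      (∀ x ∈ π.support, f x ⬝ᵥ hom (a x) = F (a x)) →
      (∀ x ∈ π.support, f (π x) ⬝ᵥ hom (a x) = F (a x)) →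
      ∑ x ∈ π.support, (interp P f h (π x) ⬝ᵥ hom (a x) / F (a x) -
        interp P f h x ⬝ᵥ hom (a x) / F (a x)) ≠ 0 := by
  let L : Equiv.Perm (Fin (m + 3)) × (Fin (m + 3) → A) → Module.Dual ℝ (Fin (m + 3) → ℝ) := fun p =>
    { toFun := fun h => ∑ x ∈ p.1.support, (interp P f h (p.1 x) ⬝ᵥ hom (p.2 x) / F (p.2 x) -
        interp P f h x ⬝ᵥ hom (p.2 x) / F (p.2 x))
      map_add' := fun h h' => by
        rw [← Finset.sum_add_distrib]
        refine Finset.sum_congr rfl fun x _ => ?_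
        simp only [interp_dot, Pi.add_apply]
        ring
      map_smul' := fun t h => by
        rw [RingHom.id_apply, smul_eq_mul, Finset.mul_sum]
        refine Finset.sum_congr rfl fun x _ => ?_
        simp only [interp_dot, Pi.smul_apply, smul_eq_mul]
        ring }
  let ι := {p : Equiv.Perm (Fin (m + 3)) × (Fin (m + 3) → A) // p.1.IsCycle ∧
    (∀ x ∈ p.1.support, ∀ y ∈ p.1.support, p.2 x = p.2 y → x = y) ∧
    (∀ x ∈ p.1.support, f x ⬝ᵥ hom (p.2 x) = F (p.2 x)) ∧
    (∀ x ∈ p.1.support, f (p.1 x) ⬝ᵥ hom (p.2 x) = F (p.2 x))}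
  -- Finitely many nonzero linear forms have a common point where none vanishes.
  obtain ⟨h, -, hh⟩ := Module.Dual.exists_forall_mem_ne_zero_of_forall_exists ⊤
    (fun p : ι => L p.1) fun p => by
      obtain ⟨h, hh⟩ := hf.exists_interp_sum_ne_zero hA hgen hF hFle p.2.1 p.2.2.1 p.2.2.2.1
        p.2.2.2.2
      exact ⟨h, trivial, hh⟩
  exact ⟨h, fun π a h1 h2 h3 h4 => hh ⟨(π, a), h1, h2, h3, h4⟩⟩

theorem eventually_add_mul_lt {a b : ℝ} (a' b' : ℝ) (h : a < b) :
    ∀ᶠ ε : ℝ in nhdsWithin 0 (Set.Ioi 0), a + ε * a' < b + ε * b' := by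
  have h1 : Continuous fun ε : ℝ => a + ε * a' := by fun_prop
  have h2 : Continuous fun ε : ℝ => b + ε * b' := by fun_prop
  have : ∀ᶠ ε : ℝ in nhds 0, a + ε * a' < b + ε * b' :=
    h1.continuousAt.eventually_lt h2.continuousAt (by simpa using h)
  exact this.filter_mono nhdsWithin_le_nhds

/-- If a minimizing functional at each point is `f (σ a)`, then the functionals can be perturbed,
and `σ` can be changed without changing the numbers of points, so that the minima are strict. -/
theorem exists_isCompatible (hf : IsEdgeSystem P.vertices f)
    (hA : (A : Set Plane) ⊆ interior P.region)
    (hgen : InGeneralPlusPosition (Set.range P.vertices ∪ (A : Set Plane)))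
    (σ : A → Fin (m + 3)) (hσ : ∀ a j, f (σ a) ⬝ᵥ hom a ≤ f j ⬝ᵥ hom a) :
    ∃ (φ : Fin (m + 3) → Fin 3 → ℝ) (τ : Equiv.Perm A), IsCompatible P φ ∧
      ∀ a j, j ≠ σ (τ a) → φ (σ (τ a)) ⬝ᵥ hom a < φ j ⬝ᵥ hom a := by
  classical
  set F : A → ℝ := fun a => f (σ a) ⬝ᵥ hom a
  have hF : ∀ a, 0 < F a := fun a => hf.dot_pos_of_mem_interior (hA a.2) _
  obtain ⟨h, hh⟩ := hf.exists_generic_heights hA hgen hF hσ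
  set T : A → Fin (m + 3) → Prop := fun a j => f j ⬝ᵥ hom a = F a
  set w : A → Fin (m + 3) → ℝ := fun a j => interp P f h j ⬝ᵥ hom a / F a
  obtain ⟨τ, hτ, hmin⟩ := (Finset.univ.filter fun τ : Equiv.Perm A =>
    ∀ a, T a (σ (τ a))).exists_min_image (fun τ => ∑ a, w a (σ (τ a))) ⟨1, by simp [T, F]⟩
  replace hτ := (Finset.mem_filter.1 hτ).2
  obtain ⟨u, hu⟩ := exists_assignment_potential_lt (fun a => σ (τ a)) T w fun π hπ a ha => by
    have h1 := sum_cycle_nonneg_of_minimal hτ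
      (fun ρ hρ => hmin (τ * ρ) (Finset.mem_filter.2 ⟨Finset.mem_univ _, hρ⟩)) π a ha
    refine lt_of_le_of_ne h1 (hh π a hπ (fun x hx y hy hxy => ?_) (fun x hx => ?_)
      fun x hx => (ha x hx).2).symm
    · rw [← (ha x hx).1, ← (ha y hy).1, hxy]
    · have := hτ (a x)
      rwa [(ha x hx).1] at this
  -- The term `u i • f i` vanishes on edge `i`, so compatibility survives, while at a tied point `a`
  -- it contributes `F a * u i`.
  set δ : Fin (m + 3) → Fin 3 → ℝ := fun i => interp P f h i + u i • f i
  have hdot : ∀ (ε : ℝ) i v, (f i + ε • δ i) ⬝ᵥ v = f i ⬝ᵥ v + ε * (δ i ⬝ᵥ v) := fun ε i v => by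
    rw [add_dotProduct, smul_dotProduct, smul_eq_mul]
  have hev1 : ∀ᶠ ε : ℝ in nhdsWithin 0 (Set.Ioi 0), ∀ i j, j ≠ i → j ≠ i + 1 →
      (f i + ε • δ i) ⬝ᵥ hom (P.vertices (i + 1)) < (f j + ε • δ j) ⬝ᵥ hom (P.vertices (i + 1)) := by
    simp only [Filter.eventually_all, hdot]
    intro i j h1 h2
    refine eventually_add_mul_lt _ _ ?_
    rw [hf.2.1]
    exact hf.2.2 j (i + 1) h2.symm fun h3 => h1 (add_right_cancel h3).symm
  have hev2 : ∀ᶠ ε : ℝ in nhdsWithin 0 (Set.Ioi 0), ∀ a j, j ≠ σ (τ a) →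
      (f (σ (τ a)) + ε • δ (σ (τ a))) ⬝ᵥ hom a < (f j + ε • δ j) ⬝ᵥ hom a := by
    simp only [Filter.eventually_all, hdot]
    intro a j hj
    -- At a tie the first-order term decides; a strict inequality survives small `ε`.
    by_cases hT : T a j
    · have hlt := hu a j hj hT
      have hδ : ∀ i, T a i → δ i ⬝ᵥ hom a = F a * (w a i + u i) := fun i hi => by
        have hFa := (hF a).ne'
        have hi' : f i ⬝ᵥ hom a = F a := hi
        simp only [δ, w, add_dotProduct, smul_dotProduct, smul_eq_mul, hi']
        field_simp
      filter_upwards [self_mem_nhdsWithin] with ε hε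
      have hε' : (0 : ℝ) < ε := hε
      rw [hδ _ (hτ a), hδ _ hT, hτ a, hT]
      have := mul_lt_mul_of_pos_left (mul_lt_mul_of_pos_left hlt (hF a)) hε'
      linarith
    · refine eventually_add_mul_lt _ _ ?_
      rw [hτ a]
      exact lt_of_le_of_ne (hσ a j) (Ne.symm hT)
  obtain ⟨ε, h1, h2⟩ := (hev1.and hev2).exists
  refine ⟨fun i => f i + ε • δ i, τ, ⟨fun i => ?_, h1⟩, h2⟩
  simp only [hdot, δ, add_dotProduct, smul_dotProduct, hf.1, hf.2.1, hf.interp_dot_left,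
    hf.interp_dot_right, smul_zero]

end IsEdgeSystem

theorem mainTheorem3 {n : ℕ} (P : Polygon Plane n) (hP : P.IsConvex)
    (A : Finset Plane) (hA : (A : Set Plane) ⊆ interior P.region)
    (hgen : InGeneralPlusPosition (Set.range P.vertices ∪ (A : Set Plane)))
    (c : Fin n → ℕ) (hc : ∑ i, c i = A.card) :
    ∃ R : Fin n → Set Plane,
      (⋃ i, R i) = P.region ∧
      (∀ i j, i ≠ j → Disjoint (interior (R i)) (interior (R j))) ∧
      ∀ i,
        Convex ℝ (R i) ∧
        IsConvexPolygonalRegion (R i) ∧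
        IsExposed ℝ (R i) (P.edgeSet ℝ i) ∧
        (∀ a ∈ A, a ∉ frontier (R i)) ∧
        ((A : Set Plane) ∩ interior (R i)).ncard = c i := by
  obtain ⟨m, rfl⟩ : ∃ m, n = m + 3 := ⟨n - 3, by have := hP.1; omega⟩
  obtain ⟨f, hf⟩ := hP.exists_isEdgeSystem
  obtain ⟨s, hs, σ, hσc, hσ⟩ := hf.exists_scaling hA hc
  obtain ⟨φ, τ, hφ, hlt⟩ := (hf.smul hs).exists_isCompatible hA hgen σ hσ
  refine exists_partition_of_isCompatible hf hφ hA (fun a => σ (τ a)) (fun i => ?_) hlt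
  rw [← hσc i]
  exact Finset.card_equiv τ fun a => by simp
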